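/- Let $d\ge 1$, $0\le k\le N$, $n=N+k$, and let $V_\tau$ ($\tau\in S(N)$) permute the first $N=n-k$ tensor factors of $(\mathbb C^d)^{\otimes n}$. Let $P^+_{r,s}$ be the projector on the maximally entangled state of systems $r,s$, and let $V^{(k)}=V^{t_n}_{n-2k+1,n}V^{t_{n-1}}_{n-2k+2,n-1}\cdots V^{t_{n-k+1}}_{n-k,n-k+1}$, where $V_{r,s}$ is the swap of systems $r,s$ and $t_s$ is partial transposition on system $s$. The multi-port teleportation (MPBT) operator with $N$ ports is $$\rho=\sum_{\mathbf i}\frac{1}{d^{N-k}}\,\mathbf 1\otimes P^+_{i_1,N+1}\otimes\cdots\otimes P^+_{i_k,N+k},$$ the sum being over all $k$-tuples $\mathbf i=(i_1,\dots,i_k)$ of pairwise distinct elements of $\{1,\dots,N\}$. Let $\mathcal M=\mathrm{span}\{V_\tau V^{(k)}V_{\tau'}^\dagger:\tau,\tau'\in S(N)\}$. For a Young diagram $\mu\vdash m$ let $d_\mu$ be the dimension of the irreducible representation (irrep) $\mu$ of $S(m)$ and $m_\mu$ its multiplicity in $(\mathbb C^d)^{\otimes m}$ (Schur–Weyl duality).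 Choose unitary matrix forms $\varphi^\alpha$ of the irreps $\alpha\vdash N-k$ and $\phi^\mu$ of the irreps $\mu\vdash N$ that are partially reduced: the basis of $\mu$ is indexed by pairs $i_\mu=(r_{\mu/\alpha},l_\alpha)$, where $\alpha\vdash N-k$ is contained in $\mu$, $r_{\mu/\alpha}$ is a path from $\mu$ to $\alpha$ in Young's lattice (removing one box in each step) and $1\le l_\alpha\le d_\alpha$, and on $S(N-k)$ one has $\phi^\mu=\bigoplus_{r_{\mu/\alpha}}\varphi^\alpha$. Put $E^\mu_{ij}=\frac{d_\mu}{N!}\sum_{\tau\in S(N)}\phi^\mu_{ji}(\tau^{-1})V_\tau$. Fix a reference index $1_\alpha$ for every $\alpha$, and for $\mu,\nu\vdash N$ with at most $d$ rows and paths $r_{\mu/\alpha}$, $r_{\nu/\beta}$ put $$F^{r_{\mu/\alpha}r_{\nu/\beta}}_{i_\mu\,j_\nu}=\frac{m_\alpha}{\sqrt{m_\mu m_\nu}}\;E^\mu_{i_\mu,(r_{\mu/\alpha},1_\alpha)}\,V^{(k)}\,E^\nu_{(r_{\nu/\beta},1_\beta),j_\nu}.$$ **Theorem.** For every set $T$ of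 representatives of the right cosets of $S(N-k)$ in $S(N)$, $\rho=\frac1{d^N}\sum_{\tau\in T}V_{\tau^{-1}}V^{(k)}V_\tau$. The operators $F^{r_{\mu/\alpha}r_{\nu/\alpha}}_{i_\mu j_\nu}$ form a basis of $\mathcal M$ and satisfy $$F^{r_{\mu/\alpha}r_{\nu/\alpha}}_{i_\mu j_\nu}F^{r_{\mu'/\beta}r_{\nu'/\beta}}_{k_{\mu'}l_{\nu'}}=\delta^{r_{\nu/\alpha}r_{\mu'/\beta}}\delta_{j_\nu k_{\mu'}}F^{r_{\mu/\alpha}r_{\nu'/\alpha}}_{i_\mu l_{\nu'}}.$$ In this basis the operator $\rho\in\mathcal M$ is diagonal, with matrix elements $$(\rho)^{r_{\mu/\alpha}r_{\nu/\beta}}_{i_\mu\,j_\nu}=\frac{k!\binom Nk}{d^N}\,\frac{m_\mu}{m_\alpha}\,\frac{d_\alpha}{d_\mu}\;\delta^{r_{\mu/\alpha}r_{\nu/\beta}}\,\delta_{i_\mu j_\nu},$$ where $\alpha,\beta\vdash N-k$ and $\mu,\nu\vdash N$ have at most $d$ rows, $\mu\supseteq\alpha$ and $\nu\supseteq\beta$.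 That is, for $\alpha=\beta$ these numbers are the coefficients of $\rho$ in the basis; and for all $\alpha,\beta$ they are equal to $\frac1{m_\alpha}\operatorname{tr}\bigl[\rho\,F^{r_{\mu/\alpha}r_{\nu/\beta}}_{i_\mu\,j_\nu}\bigr]$. -/

import Mathlib

noncomputable section

namespace MPBT

open scoped Classical Matrix

/-! ### Young diagrams, paths in Young's lattice, irreducible representations of `S(n)` -/

/-- Young diagrams with `n` boxes. -/
abbrev YD (n : ℕ) : Type := {μ : YoungDiagram // μ.card = n}

/-- A path `(μ = μ_0, μ_1, …, μ_k = α)` in Young's lattice, removing one box in each step. -/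
@[ext] structure YoungPath (k : ℕ) (μ α : YoungDiagram) where
  seq : Fin (k + 1) → YoungDiagram
  seq_zero : seq 0 = μ
  seq_last : seq (Fin.last k) = α
  covBy : ∀ i : Fin k, seq i.succ ⋖ seq i.castSucc

/-- The complex group algebra of `S(n)`. -/
abbrev GA (n : ℕ) : Type := MonoidAlgebra ℂ (Equiv.Perm (Fin n))

/-- A numbering of the boxes of a Young diagram. The isomorphism class of the
module built from it below does not depend on the numbering. -/
def filling {n : ℕ} (μ : YD n) : Fin n ≃ μ.1.cells :=
  (Finset.equivFinOfCardEq μ.2).symm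

/-- The row symmetrizer: the sum of all permutations that preserve every row. -/
def rowSym {n : ℕ} (μ : YD n) : GA n :=
  ∑ σ : Equiv.Perm (Fin n),
    if ∀ i, (filling μ (σ i)).1.1 = (filling μ i).1.1 then MonoidAlgebra.of ℂ _ σ else 0

/-- The column antisymmetrizer: the signed sum of all permutations that preserve every column. -/
def colAlt {n : ℕ} (μ : YD n) : GA n :=
  ∑ σ : Equiv.Perm (Fin n),
    if ∀ i, (filling μ (σ i)).1.2 = (filling μ i).1.2 then
      ((Equiv.Perm.sign σ : ℤ) : ℂ) • MonoidAlgebra.of ℂ _ σ else 0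

/-- The irreducible representation of `S(n)` labelled by `μ` (the Specht module): the left ideal
of the group algebra generated by the Young symmetrizer of `μ`. -/
abbrev Specht {n : ℕ} (μ : YD n) : Ideal (GA n) := Ideal.span {rowSym μ * colAlt μ}

/-- `d_μ`, the dimension of the irreducible representation labelled by `μ`. -/
def dimIrr {n : ℕ} (μ : YD n) : ℕ := Module.finrank ℂ (Specht μ)

/-- The matrix element `φ^μ_{ij}(σ)` of the irreducible representation labelled by `μ`
with respect to a basis `b`, so that `σ b_j = ∑ i, φ_{ij}(σ) b_i`. -/
def matElt {n : ℕ} {μ : YD n} {ι : Type} (b : Module.Basis ι ℂ (Specht μ))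
    (σ : Equiv.Perm (Fin n)) (i j : ι) : ℂ :=
  b.repr ((MonoidAlgebra.of ℂ _ σ : GA n) • b j) i

/-- All matrices `φ^μ(σ)` in the basis `b` are unitary: `φ(σ)⁻¹ = φ(σ)†`. -/
def IsUnitaryForm {n : ℕ} {μ : YD n} {ι : Type} (b : Module.Basis ι ℂ (Specht μ)) : Prop :=
  ∀ (σ : Equiv.Perm (Fin n)) (i j : ι), matElt b σ⁻¹ i j = star (matElt b σ j i)

/-- `S(m)` inside `S(n)`, `m ≤ n`, permuting the first `m` of `n` points. -/
def emb {m n : ℕ} (h : m ≤ n) : Equiv.Perm (Fin m) →* Equiv.Perm (Fin n) :=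
  Equiv.Perm.viaEmbeddingHom (Fin.castLEEmb h)

/-- A basis index `i_μ = (r_{μ/α}, l_α)` of the irrep `μ ⊢ N`, divided at level `N - k`:
a diagram `α ⊢ N - k`, a path from `μ` to `α`, and an index `l_α` of the irrep `α`. -/
@[ext] structure Idx {N : ℕ} (k : ℕ) (μ : YD N) where
  α : YD (N - k)
  r : YoungPath k μ.1 α.1
  l : Fin (dimIrr α)

/-- Partially reduced irreducible representations (PRIR) of `S(N)` with respect to `S(N - k)`:
a choice of bases of the irreps of `S(N - k)` and `S(N)` in which all representation matrices
are unitary and the restriction of every `φ^μ`, `μ ⊢ N`, to `S(N - k)` is block diagonal,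
`φ^μ(κ) = ⨁_{r_{μ/α}} φ^α(κ)`. -/
structure PRIR (N k : ℕ) where
  low : ∀ α : YD (N - k), Module.Basis (Fin (dimIrr α)) ℂ (Specht α)
  high : ∀ μ : YD N, Module.Basis (Idx k μ) ℂ (Specht μ)
  low_unitary : ∀ α, IsUnitaryForm (low α)
  high_unitary : ∀ μ, IsUnitaryForm (high μ)
  restrict_same : ∀ (μ : YD N) (α : YD (N - k)) (r : YoungPath k μ.1 α.1)
    (l l' : Fin (dimIrr α)) (κ : Equiv.Perm (Fin (N - k))),
    matElt (high μ) (emb (Nat.sub_le N k) κ) ⟨α, r, l⟩ ⟨α, r, l'⟩ = matElt (low α) κ l l'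
  restrict_ne : ∀ (μ : YD N) (α β : YD (N - k)) (r : YoungPath k μ.1 α.1)
    (s : YoungPath k μ.1 β.1) (l : Fin (dimIrr α)) (l' : Fin (dimIrr β))
    (κ : Equiv.Perm (Fin (N - k))), r.seq ≠ s.seq →
    matElt (high μ) (emb (Nat.sub_le N k) κ) ⟨α, r, l⟩ ⟨β, s, l'⟩ = 0

/-! ### Operators on `(ℂ^d)^{⊗ n}`, as matrices in the computational basis -/

/-- Operators on `(ℂ^d)^{⊗ n}`; the basis vector `|x_1 … x_n⟩` is the function `x`. -/
abbrev Op (d n : ℕ) : Type := Matrix (Fin n → Fin d) (Fin n → Fin d) ℂ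

/-- The permutation operator: `V_τ |x⟩ = |x ∘ τ⁻¹⟩`. -/
def permOp (d : ℕ) {n : ℕ} (τ : Equiv.Perm (Fin n)) : Op d n :=
  Matrix.of fun y x => if y = x ∘ ⇑τ⁻¹ then 1 else 0

/-- The partial transposition with respect to the system `s`. -/
def partialTranspose {d n : ℕ} (s : Fin n) (A : Op d n) : Op d n :=
  Matrix.of fun x y => A (Function.update x s (y s)) (Function.update y s (x s))

/-- `P⁺_{r,s} ⊗ 1`, the projector on the maximally entangled state
`d^{-1/2} ∑_i |ii⟩` of the systems `r ≠ s`. -/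
def maxEnt (d : ℕ) {n : ℕ} (r s : Fin n) : Op d n :=
  Matrix.of fun x y =>
    if x r = x s ∧ y r = y s ∧ ∀ t, t ≠ r → t ≠ s → x t = y t then (d : ℂ)⁻¹ else 0

/-- The space of `S(n)`-equivariant linear maps from the irrep `μ ⊢ n` to `(ℂ^d)^{⊗ n}`. -/
def intertwiners (d : ℕ) {n : ℕ} (μ : YD n) :
    Submodule ℂ (Specht μ →ₗ[ℂ] ((Fin n → Fin d) → ℂ)) where
  carrier := {f | ∀ (σ : Equiv.Perm (Fin n)) (v : Specht μ),
    f ((MonoidAlgebra.of ℂ _ σ : GA n) • v) = permOp d σ *ᵥ f v}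
  add_mem' := by
    intro f g hf hg σ v
    simp only [LinearMap.add_apply, hf σ v, hg σ v, Matrix.mulVec_add]
  zero_mem' := by
    intro σ v
    simp
  smul_mem' := by
    intro c f hf σ v
    simp only [LinearMap.smul_apply, hf σ v, Matrix.mulVec_smul]

/-- `m_μ`, the multiplicity of the irrep `μ ⊢ n` of `S(n)` in `(ℂ^d)^{⊗ n}`. -/
def mult (d : ℕ) {n : ℕ} (μ : YD n) : ℕ := Module.finrank ℂ (intertwiners d μ)

/-! ### The multi-port teleportation operator: `N` ports, `k` teleported systems, `n = N + k` -/

/-- `V_τ` for `τ ∈ S(N)` acting on the first `N` of the `N + k` systems. -/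
def portPerm (d N k : ℕ) (τ : Equiv.Perm (Fin N)) : Op d (N + k) :=
  permOp d (emb (Nat.le_add_right N k) τ)

/-- The signal `σ_𝐢 = d^{-(N-k)} 1 ⊗ P⁺_{i_1, N+1} ⊗ ⋯ ⊗ P⁺_{i_k, N+k}` for a `k`-tuple `𝐢` of
pairwise distinct ports. -/
def signal (d N k : ℕ) (i : Fin k ↪ Fin N) : Op d (N + k) :=
  ((d : ℂ) ^ (N - k))⁻¹ •
    (List.ofFn fun l : Fin k => maxEnt d (Fin.castAdd k (i l)) (Fin.natAdd N l)).prod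

/-- The MPBT operator `ρ = ∑_𝐢 σ_𝐢`. -/
def mpbt (d N k : ℕ) : Op d (N + k) := ∑ i : Fin k ↪ Fin N, signal d N k i

/-- `V^{(k)} = V^{t_n}_{n-2k+1,n} V^{t_{n-1}}_{n-2k+2,n-1} ⋯ V^{t_{n-k+1}}_{n-k,n-k+1}`,
with `n = N + k`. Systems are numbered from `0` in the code. -/
def Vk (d N k : ℕ) (hk : k ≤ N) : Op d (N + k) :=
  (List.ofFn fun j : Fin k =>
    partialTranspose (⟨N + k - 1 - j, by omega⟩ : Fin (N + k))
      (permOp d (Equiv.swap (⟨N - k + j, by omega⟩ : Fin (N + k))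
        ⟨N + k - 1 - j, by omega⟩))).prod

/-- The ideal `𝓜`, spanned by the operators `V_τ V^{(k)} V_{τ'}†`, `τ, τ' ∈ S(N)`. -/
def idealM (d N k : ℕ) (hk : k ≤ N) : Submodule ℂ (Op d (N + k)) :=
  Submodule.span ℂ {X | ∃ τ τ' : Equiv.Perm (Fin N),
    X = portPerm d N k τ * Vk d N k hk * (portPerm d N k τ')ᴴ}

/-- `E^μ_{ij} = (d_μ / N!) ∑_{τ ∈ S(N)} φ^μ_{ji}(τ⁻¹) V_τ` in the PRIR basis, acting on the
first `N` systems. -/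
def Eop (d : ℕ) {N k : ℕ} (R : PRIR N k) (μ : YD N) (i j : Idx k μ) : Op d (N + k) :=
  ((dimIrr μ : ℂ) / (N.factorial : ℂ)) •
    ∑ τ : Equiv.Perm (Fin N), matElt (R.high μ) τ⁻¹ j i • portPerm d N k τ

/-- One half of the labels of an operator `F`: the pair `(r_{μ/α}, i_μ)`, where `α ⊢ N - k`,
`μ ⊢ N` has at most `d` rows, `r_{μ/α}` is a path and `i_μ` is a basis index of `μ`. -/
@[ext] structure Label (d N k : ℕ) where
  α : YD (N - k)
  μ : YD N
  rows : μ.1.colLen 0 ≤ d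
  r : YoungPath k μ.1 α.1
  i : Idx k μ

/-- `F^{r_{μ/α} r_{ν/β}}_{i_μ j_ν} = m_α / √(m_μ m_ν) • E^{r_{μ/α}}_{i_μ 1_α} V^{(k)}
E^{r_{ν/β}}_{1_β j_ν}`, where `x = (r_{μ/α}, i_μ)`, `y = (r_{ν/β}, j_ν)`, and `one α` is the
reference index `1_α`. The operators of the basis are those with `α = β`. -/
def Fop (d : ℕ) {N k : ℕ} (hk : k ≤ N) (R : PRIR N k)
    (one : ∀ α : YD (N - k), Fin (dimIrr α)) (x y : Label d N k) : Op d (N + k) :=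
  ((mult d x.α : ℂ) / (Real.sqrt ((mult d x.μ : ℝ) * (mult d y.μ : ℝ)) : ℂ)) •
    (Eop d R x.μ x.i ⟨x.α, x.r, one x.α⟩ * Vk d N k hk *
      Eop d R y.μ ⟨y.α, y.r, one y.α⟩ y.i)

/-- Labels of the operator basis: pairs of labels with the same `α`. -/
abbrev BasisLabel (d N k : ℕ) : Type := {p : Label d N k × Label d N k // p.1.α = p.2.α}

/-- `λ_μ(α) = (k! C(N,k) / d^N) (m_μ / m_α) (d_α / d_μ)`. -/
def eigval (d : ℕ) {N k : ℕ} (α : YD (N - k)) (μ : YD N) : ℂ :=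
  ((k.factorial : ℂ) * (N.choose k : ℂ)) / (d : ℂ) ^ N *
    ((mult d μ : ℂ) / (mult d α : ℂ)) * ((dimIrr α : ℂ) / (dimIrr μ : ℂ))

end MPBT

end

noncomputable section

namespace MPBT

open scoped Classical Matrix

/-! The operator `V^{(k)}` is `d^k` times a product of maximally entangled projectors joining the
last `k` ports to the `k` teleported systems. Conjugating it by port permutations gives every other
signal, up to the scalar `d^N`. Since `S(N-k)` is the pointwise stabilizer of the coupled ports, the
injective `k`-tuples of ports correspond to its right cosets, so `ρ` is a sum over coset
representatives, or equally an average over all of `S(N)`.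

The composition rule rests on one compression formula (`Vk_mul_Eop_mul_Vk`). Sandwiching a port
permutation between two copies of `V^{(k)}` acts as a partial trace over the last ports, and so
gives a multiple of an element of `S(N-k)` times `V^{(k)}`. For a matrix unit of `S(N)` in the
partially reduced basis, the units of `S(N-k)` can be moved through `V^{(k)}`; they show that the
result vanishes for different `α` and, for equal `α`, is a multiple of one unit. Comparing traces
gives the multiple: `m_μ / m_α` for equal paths, zero otherwise. The factor `m_α / √(m_μ m_ν)`
normalizes exactly this, so the `F` multiply as matrix units. Their trace form gives independence;
inserting the resolution of the identity on both sides of `V^{(k)}` shows that they span.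

For the spectrum, `V^{(k)}` is expanded as `∑ E^μ_{aa} V^{(k)} E^ν_{bb}` and averaged. Orthogonality
of matrix elements keeps only `μ = ν` and `a = b`, with weight `N!/d_μ`. The terms that differ only
in the index `l_α` coincide, which gives the factor `d_α`, and each of them is `m_μ/m_α` times a
diagonal `F`.

The argument uses orthogonality and completeness of the Specht modules, obtained here from Young
symmetrizers: Schur's lemma from the products `youngSym μ * x * youngSym ν`, completeness by
comparing the number of diagrams with the number of conjugacy classes. It also uses that `m_μ` is
the trace of a diagonal matrix unit, that `m_μ ≠ 0` when `μ` has at most `d` rows, and that the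
units of `μ` vanish when it has more. -/

/-! ### Combinatorics of two numberings, with a numerical weight in place of the dominance order. -/

/-- The statistic `n(μ)`: the sum of the row indices of all cells. -/
def rowWeight (μ : YoungDiagram) : ℕ := ∑ c ∈ μ.cells, c.1

/-- Passing from the initial segment to `S` exchanges equally many elements below `S.card` for
elements that are at least `S.card`. -/
lemma range_card_le_sum (S : Finset ℕ) :
    ∑ x ∈ Finset.range S.card, x ≤ ∑ x ∈ S, x ∧
      (∑ x ∈ Finset.range S.card, x = ∑ x ∈ S, x → S = Finset.range S.card) := by
  set R := Finset.range S.card with hR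
  have hcard : R.card = S.card := by simp [hR]
  have hdiff : (R \ S).card = (S \ R).card :=
    Finset.card_sdiff_comm hcard
  have h1 : ∑ x ∈ R \ S, x + ∑ x ∈ R ∩ S, x = ∑ x ∈ R, x := by
    rw [add_comm]; exact Finset.sum_inter_add_sum_sdiff R S _
  have h2 : ∑ x ∈ S \ R, x + ∑ x ∈ S ∩ R, x = ∑ x ∈ S, x := by
    rw [add_comm]; exact Finset.sum_inter_add_sum_sdiff S R _
  -- The extra `1` per exchanged element makes the inequality strict unless `R \ S` is empty, which
  -- settles the equality case.
  have h3 : ∑ x ∈ R \ S, (x + 1) ≤ (R \ S).card * S.card := by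
    rw [← smul_eq_mul]
    refine Finset.sum_le_card_nsmul _ _ _ fun x hx => ?_
    have := Finset.mem_range.1 (hR ▸ (Finset.mem_sdiff.1 hx).1)
    omega
  have h4 : (S \ R).card * S.card ≤ ∑ x ∈ S \ R, x := by
    rw [← smul_eq_mul]
    refine Finset.card_nsmul_le_sum _ _ _ fun x hx => ?_
    have := (Finset.mem_sdiff.1 hx).2
    rw [hR, Finset.mem_range] at this
    omega
  rw [Finset.sum_add_distrib, Finset.sum_const, smul_eq_mul, mul_one] at h3
  rw [← hdiff] at h4
  rw [Finset.inter_comm S R] at h2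
  refine ⟨by omega, fun h => ?_⟩
  have h0 : (R \ S).card = 0 := by omega
  have h0' : (S \ R).card = 0 := by omega
  rw [Finset.card_eq_zero, Finset.sdiff_eq_empty_iff_subset] at h0 h0'
  exact Finset.Subset.antisymm h0' h0

section Numberings

variable {n : ℕ} {l m : YoungDiagram} (F : Fin n ≃ l.cells) (G : Fin n ≃ m.cells)

lemma sum_cells_eq {M : Type*} [AddCommMonoid M] (f : ℕ × ℕ → M) :
    ∑ i, f (F i).1 = ∑ c ∈ l.cells, f c := by
  rw [← Finset.sum_coe_sort l.cells f]
  exact Equiv.sum_comp F fun c : l.cells => f c.1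

lemma sum_column_eq {c : ℕ} :
    ∑ i with (G i).1.2 = c, (G i).1.1 = ∑ x ∈ Finset.range (m.colLen c), x := by
  rw [Finset.sum_filter, sum_cells_eq G (fun x => if x.2 = c then x.1 else 0),
    ← Finset.sum_filter]
  change ∑ x ∈ m.col c, x.1 = _
  rw [YoungDiagram.col_eq_prod, Finset.sum_product]
  simp

lemma card_column_eq {c : ℕ} :
    (Finset.univ.filter fun i => (G i).1.2 = c).card = m.colLen c := by
  rw [Finset.card_eq_sum_ones, Finset.sum_filter,
    sum_cells_eq G (fun x => if x.2 = c then 1 else 0), ← Finset.sum_filter,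
    ← Finset.card_eq_sum_ones, YoungDiagram.colLen_eq_card]
  rfl

lemma card_row_eq {r : ℕ} :
    (Finset.univ.filter fun i => (F i).1.1 = r).card = l.rowLen r := by
  rw [Finset.card_eq_sum_ones, Finset.sum_filter,
    sum_cells_eq F (fun x => if x.1 = r then 1 else 0), ← Finset.sum_filter,
    ← Finset.card_eq_sum_ones, YoungDiagram.rowLen_eq_card]
  rfl

variable {F G}

/-- Within a column of `G` the points lie in distinct rows of `F`, so their `F`-row indices sum to
at least `0 + 1 + ⋯`, which is the sum of their `G`-row indices. In the equality case these rows
fill an initial segment in each column, so every mixed cell belongs to `m`. -/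
lemma rowWeight_le_of_injective (h : Function.Injective fun i => ((F i).1.1, (G i).1.2)) :
    rowWeight m ≤ rowWeight l ∧
      (rowWeight m = rowWeight l → ∀ i, ((F i).1.1, (G i).1.2) ∈ m) := by
  have key : ∀ c, ∑ i with (G i).1.2 = c, (G i).1.1 ≤ ∑ i with (G i).1.2 = c, (F i).1.1 ∧
      (∑ i with (G i).1.2 = c, (G i).1.1 = ∑ i with (G i).1.2 = c, (F i).1.1 →
        ∀ i, (G i).1.2 = c → ((F i).1.1, c) ∈ m) := by
    intro c
    have hinj : Set.InjOn (fun i => (F i).1.1)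
        (Finset.univ.filter fun i => (G i).1.2 = c : Finset (Fin n)) := by
      intro i hi j hj hij
      simp only [Finset.coe_filter, Finset.mem_univ, true_and, Set.mem_ofPred_eq] at hi hj
      exact h (Prod.ext hij (hi.trans hj.symm))
    have hS := range_card_le_sum
      ((Finset.univ.filter fun i => (G i).1.2 = c).image fun i => (F i).1.1)
    rw [Finset.card_image_of_injOn hinj, Finset.sum_image hinj, card_column_eq,
      ← sum_column_eq G] at hS
    refine ⟨hS.1, fun he i hi => ?_⟩
    have := hS.2 he
    rw [YoungDiagram.mem_iff_lt_colLen, ← Finset.mem_range, ← this]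
    exact Finset.mem_image.2 ⟨i, by simpa using hi, rfl⟩
  have hfib : ∀ f : Fin n → ℕ, ∑ i, f i =
      ∑ c ∈ Finset.univ.image (fun i => (G i).1.2), ∑ i with (G i).1.2 = c, f i := fun f =>
    (Finset.sum_fiberwise_of_maps_to (fun i _ => Finset.mem_image_of_mem _ (Finset.mem_univ i))
      f).symm
  unfold rowWeight
  rw [← sum_cells_eq F (fun x => x.1), ← sum_cells_eq G (fun x => x.1),
    hfib fun i => (F i).1.1, hfib fun i => (G i).1.1]
  refine ⟨Finset.sum_le_sum fun c _ => (key c).1, fun he i => ?_⟩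
  have := (Finset.sum_eq_sum_iff_of_le fun c _ => (key c).1).1 he _
    (Finset.mem_image_of_mem _ (Finset.mem_univ i))
  exact (key _).2 this i rfl

/-- The mixed cells give a new numbering of `m` in which each point keeps its row from `F`, so the
two diagrams have the same row lengths. -/
lemma eq_of_injective_of_mem (h : Function.Injective fun i => ((F i).1.1, (G i).1.2))
    (hm : ∀ i, ((F i).1.1, (G i).1.2) ∈ m) : l = m := by
  have hcard : Fintype.card (Fin n) = Fintype.card m.cells := Fintype.card_congr G
  have hb : Function.Bijective (fun i => (⟨((F i).1.1, (G i).1.2), hm i⟩ : m.cells)) := by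
    rw [Fintype.bijective_iff_injective_and_card]
    exact ⟨fun i j hij => h (congrArg Subtype.val hij), hcard⟩
  have hrow : ∀ r, l.rowLen r = m.rowLen r := by
    intro r
    rw [← card_row_eq F, ← card_row_eq (Equiv.ofBijective _ hb)]
    rfl
  ext ⟨i, j⟩
  simp only [YoungDiagram.mem_cells, YoungDiagram.mem_iff_lt_rowLen, hrow]

end Numberings

/-! ### Symmetrizers -/

/-- The permutation `σ` as an element of the group algebra. -/
abbrev gaOf {n : ℕ} (σ : Equiv.Perm (Fin n)) : GA n := MonoidAlgebra.of ℂ _ σ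

section Symmetrizers

variable {n : ℕ} {μ ν : YD n}

lemma rowSym_mul_of {σ : Equiv.Perm (Fin n)}
    (h : ∀ i, (filling μ (σ i)).1.1 = (filling μ i).1.1) : rowSym μ * gaOf σ = rowSym μ := by
  unfold rowSym
  rw [Finset.sum_mul]
  refine Fintype.sum_equiv (Equiv.mulRight σ) _ _ fun τ => ?_
  have : (∀ i, (filling μ ((τ * σ) i)).1.1 = (filling μ i).1.1) ↔
      ∀ i, (filling μ (τ i)).1.1 = (filling μ i).1.1 := by
    refine ⟨fun H i => ?_, fun H i => (H (σ i)).trans (h i)⟩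
    have h1 := H (σ⁻¹ i)
    have h2 := h (σ⁻¹ i)
    simp only [Equiv.Perm.mul_apply, Equiv.Perm.coe_inv, Equiv.apply_symm_apply] at h1 h2
    exact h1.trans h2.symm
  simp only [Equiv.coe_mulRight, this, ite_mul, zero_mul, gaOf, map_mul]

lemma of_mul_rowSym {σ : Equiv.Perm (Fin n)}
    (h : ∀ i, (filling μ (σ i)).1.1 = (filling μ i).1.1) : gaOf σ * rowSym μ = rowSym μ := by
  unfold rowSym
  rw [Finset.mul_sum]
  refine Fintype.sum_equiv (Equiv.mulLeft σ) _ _ fun τ => ?_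
  have : (∀ i, (filling μ ((σ * τ) i)).1.1 = (filling μ i).1.1) ↔
      ∀ i, (filling μ (τ i)).1.1 = (filling μ i).1.1 := by
    refine forall_congr' fun i => ?_
    rw [Equiv.Perm.mul_apply, h]
  simp only [Equiv.coe_mulLeft, this, mul_ite, mul_zero, gaOf, map_mul]

lemma sign_mul_self_complex (σ : Equiv.Perm (Fin n)) :
    (((Equiv.Perm.sign σ : ℤ) : ℂ)) * ((Equiv.Perm.sign σ : ℤ) : ℂ) = 1 := by
  rcases Int.units_eq_one_or (Equiv.Perm.sign σ) with h | h <;> simp [h]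

lemma colAlt_mul_of {σ : Equiv.Perm (Fin n)}
    (h : ∀ i, (filling μ (σ i)).1.2 = (filling μ i).1.2) :
    colAlt μ * gaOf σ = ((Equiv.Perm.sign σ : ℤ) : ℂ) • colAlt μ := by
  unfold colAlt
  rw [Finset.sum_mul, Finset.smul_sum]
  refine Fintype.sum_equiv (Equiv.mulRight σ) _ _ fun τ => ?_
  have : (∀ i, (filling μ ((τ * σ) i)).1.2 = (filling μ i).1.2) ↔
      ∀ i, (filling μ (τ i)).1.2 = (filling μ i).1.2 := by
    refine ⟨fun H i => ?_, fun H i => (H (σ i)).trans (h i)⟩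
    have h1 := H (σ⁻¹ i)
    have h2 := h (σ⁻¹ i)
    simp only [Equiv.Perm.mul_apply, Equiv.Perm.coe_inv, Equiv.apply_symm_apply] at h1 h2
    exact h1.trans h2.symm
  simp only [Equiv.coe_mulRight, this, ite_mul, zero_mul, gaOf, map_mul, smul_ite, smul_zero,
    smul_smul, Units.val_mul, Int.cast_mul, smul_mul_assoc]
  rw [mul_left_comm, sign_mul_self_complex, mul_one]

lemma of_mul_colAlt {σ : Equiv.Perm (Fin n)}
    (h : ∀ i, (filling μ (σ i)).1.2 = (filling μ i).1.2) :
    gaOf σ * colAlt μ = ((Equiv.Perm.sign σ : ℤ) : ℂ) • colAlt μ := by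
  unfold colAlt
  rw [Finset.mul_sum, Finset.smul_sum]
  refine Fintype.sum_equiv (Equiv.mulLeft σ) _ _ fun τ => ?_
  have : (∀ i, (filling μ ((σ * τ) i)).1.2 = (filling μ i).1.2) ↔
      ∀ i, (filling μ (τ i)).1.2 = (filling μ i).1.2 := by
    refine forall_congr' fun i => ?_
    rw [Equiv.Perm.mul_apply, h]
  simp only [Equiv.coe_mulLeft, this, mul_ite, mul_zero, gaOf, map_mul, smul_ite, smul_zero,
    smul_smul, Units.val_mul, Int.cast_mul, mul_smul_comm]
  rw [← mul_assoc, sign_mul_self_complex, one_mul]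

lemma swap_preserves {β : Type*} {f : Fin n → β} {i j : Fin n} (h : f i = f j) (k : Fin n) :
    f (Equiv.swap i j k) = f k := by
  by_cases h1 : k = i
  · subst h1; simp [h]
  by_cases h2 : k = j
  · subst h2; simp [h]
  rw [Equiv.swap_apply_of_ne_of_ne h1 h2]

lemma self_eq_neg_complex {M : Type*} [AddCommGroup M] [Module ℂ M] {x : M} (h : x = -x) :
    x = 0 := by
  have h2 : (2 : ℂ) • x = 0 := by
    rw [two_smul]
    nth_rewrite 2 [h]
    exact add_neg_cancel x
  exact (smul_eq_zero.1 h2).resolve_left two_ne_zero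

lemma of_mul_of_swap (π : Equiv.Perm (Fin n)) (i j : Fin n) :
    gaOf (Equiv.swap i j) * gaOf π = gaOf π * gaOf (Equiv.swap (π⁻¹ i) (π⁻¹ j)) := by
  rw [gaOf, gaOf, gaOf, ← map_mul, ← map_mul]
  congr 1
  rw [Equiv.swap_mul_eq_mul_swap]

/-- A transposition of two points in a common row and a common transported column is absorbed by the
row symmetrizer, and becomes `-1` once it is moved through `π` to the antisymmetrizer. -/
lemma rowSym_of_colAlt_eq_zero (π : Equiv.Perm (Fin n))
    (h : ¬ Function.Injective fun i => ((filling μ i).1.1, (filling ν (π⁻¹ i)).1.2)) :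
    rowSym μ * gaOf π * colAlt ν = 0 := by
  simp only [Function.Injective, Prod.mk.injEq, not_forall] at h
  obtain ⟨i, j, ⟨h1, h2⟩, hij⟩ := h
  have ha := rowSym_mul_of (μ := μ) (σ := Equiv.swap i j)
    (swap_preserves (f := fun k => (filling μ k).1.1) h1)
  have hb := of_mul_colAlt (μ := ν) (σ := Equiv.swap (π⁻¹ i) (π⁻¹ j))
    (swap_preserves (f := fun k => (filling ν k).1.2) h2)
  rw [Equiv.Perm.sign_swap (by simpa using hij)] at hb
  have : rowSym μ * gaOf π * colAlt ν = -(rowSym μ * gaOf π * colAlt ν) := by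
    conv_lhs => rw [← ha, mul_assoc (rowSym μ), of_mul_of_swap, ← mul_assoc, mul_assoc, hb]
    simp
  exact self_eq_neg_complex this

lemma colAlt_of_rowSym_eq_zero (π : Equiv.Perm (Fin n))
    (h : ¬ Function.Injective fun i => ((filling ν (π⁻¹ i)).1.1, (filling μ i).1.2)) :
    colAlt μ * gaOf π * rowSym ν = 0 := by
  simp only [Function.Injective, Prod.mk.injEq, not_forall] at h
  obtain ⟨i, j, ⟨h1, h2⟩, hij⟩ := h
  have ha := colAlt_mul_of (μ := μ) (σ := Equiv.swap i j)
    (swap_preserves (f := fun k => (filling μ k).1.2) h2)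
  have hb := of_mul_rowSym (μ := ν) (σ := Equiv.swap (π⁻¹ i) (π⁻¹ j))
    (swap_preserves (f := fun k => (filling ν k).1.1) h1)
  rw [Equiv.Perm.sign_swap hij] at ha
  have : colAlt μ * gaOf π * rowSym ν = -(colAlt μ * gaOf π * rowSym ν) := by
    conv_lhs => rw [← hb, ← mul_assoc, mul_assoc (colAlt μ), ← of_mul_of_swap, ← mul_assoc, ha]
    simp
  exact self_eq_neg_complex this

/-- Induction on elements of the group algebra: sums of multiples of permutations. -/
lemma ga_induction {P : GA n → Prop} (h0 : P 0) (hadd : ∀ x y, P x → P y → P (x + y))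
    (hsmul : ∀ (c : ℂ) σ, P (c • gaOf σ)) (x : GA n) : P x := by
  refine MonoidAlgebra.induction_linear x h0 hadd fun σ c => ?_
  have := hsmul c σ
  rwa [gaOf, MonoidAlgebra.of_apply, MonoidAlgebra.smul_single', mul_one] at this

/-- The Young symmetrizer. -/
abbrev youngSym (μ : YD n) : GA n := rowSym μ * colAlt μ

/-- The product contains a factor `rowSym μ * _ * colAlt ν` and a factor `colAlt μ * _ * rowSym ν`.
If neither type vanished identically, the row weights would be ordered both ways, and the equality
case would give `μ = ν`. -/
lemma youngSym_mul_youngSym_ne (h : μ ≠ ν) (x : GA n) : youngSym μ * x * youngSym ν = 0 := by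
  have hcases : (∀ π, rowSym μ * gaOf π * colAlt ν = 0) ∨
      (∀ π, colAlt μ * gaOf π * rowSym ν = 0) := by
    by_contra hcon
    push Not at hcon
    obtain ⟨⟨π, hπ⟩, ⟨τ, hτ⟩⟩ := hcon
    have h1 := not_not.1 (mt (rowSym_of_colAlt_eq_zero π) hπ)
    have h2 := not_not.1 (mt (colAlt_of_rowSym_eq_zero τ) hτ)
    have k1 := rowWeight_le_of_injective (F := filling μ)
      (G := (π⁻¹ : Equiv.Perm (Fin n)).trans (filling ν)) h1
    have k2 := rowWeight_le_of_injective (G := filling μ)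
      (F := (τ⁻¹ : Equiv.Perm (Fin n)).trans (filling ν)) h2
    exact h (Subtype.ext (eq_of_injective_of_mem (F := filling μ)
      (G := (π⁻¹ : Equiv.Perm (Fin n)).trans (filling ν)) h1
      (k1.2 (le_antisymm k1.1 k2.1))))
  rcases hcases with H | H
  · have H' : ∀ y : GA n, rowSym μ * y * colAlt ν = 0 := fun y => by
      refine ga_induction (P := fun y => rowSym μ * y * colAlt ν = 0) (by simp)
        (fun a b ha hb => by rw [mul_add, add_mul, ha, hb, add_zero]) (fun c σ => ?_) y
      rw [mul_smul_comm, smul_mul_assoc, H, smul_zero]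
    calc _ = rowSym μ * (colAlt μ * x * rowSym ν) * colAlt ν := by simp only [mul_assoc]
      _ = 0 := H' _
  · have H' : ∀ y : GA n, colAlt μ * y * rowSym ν = 0 := fun y => by
      refine ga_induction (P := fun y => colAlt μ * y * rowSym ν = 0) (by simp)
        (fun a b ha hb => by rw [mul_add, add_mul, ha, hb, add_zero]) (fun c σ => ?_) y
      rw [mul_smul_comm, smul_mul_assoc, H, smul_zero]
    calc _ = rowSym μ * (colAlt μ * x * rowSym ν) * colAlt ν := by simp only [mul_assoc]
      _ = 0 := by rw [H', mul_zero, zero_mul]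

/-- Von Neumann's lemma: a permutation that is not killed by a common row and column factors as a
row permutation times a column permutation, and both factors are absorbed up to sign. -/
lemma rowSym_mul_colAlt_mem (x : GA n) : ∃ z : ℂ, rowSym μ * x * colAlt μ = z • youngSym μ := by
  refine ga_induction (P := fun x => ∃ z : ℂ, rowSym μ * x * colAlt μ = z • youngSym μ)
    ⟨0, by simp⟩ ?_ ?_ x
  · rintro a b ⟨z, hz⟩ ⟨w, hw⟩
    exact ⟨z + w, by rw [mul_add, add_mul, hz, hw, add_smul]⟩
  intro c π
  by_cases h : Function.Injective fun i => ((filling μ i).1.1, (filling μ (π⁻¹ i)).1.2)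
  swap
  · exact ⟨0, by rw [mul_smul_comm, smul_mul_assoc, rowSym_of_colAlt_eq_zero π h]; simp⟩
  -- Both numberings are of the same diagram `μ`, so the weights agree and the equality case
  -- applies.
  have hmem := (rowWeight_le_of_injective (F := filling μ)
      (G := (π⁻¹ : Equiv.Perm (Fin n)).trans (filling μ)) h).2 rfl
  have hb : Function.Bijective
      (fun i => (⟨((filling μ i).1.1, (filling μ (π⁻¹ i)).1.2), hmem i⟩ : μ.1.cells)) := by
    rw [Fintype.bijective_iff_injective_and_card]
    exact ⟨fun i j hij => h (congrArg Subtype.val hij), Fintype.card_congr (filling μ)⟩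
  set H := Equiv.ofBijective _ hb with hH
  -- `p` preserves rows, `q` preserves columns, `π = p⁻¹ q`
  set p : Equiv.Perm (Fin n) := H.trans (filling μ).symm with hp
  have hp1 : ∀ i, (filling μ (p⁻¹ i)).1.1 = (filling μ i).1.1 := by
    intro i
    have : filling μ (p (p⁻¹ i)) = H (p⁻¹ i) := by simp [hp]
    rw [Equiv.Perm.coe_inv, Equiv.apply_symm_apply] at this
    rw [this]
    rfl
  have hq1 : ∀ i, (filling μ ((p * π) i)).1.2 = (filling μ i).1.2 := by
    intro i
    have : filling μ (p (π i)) = H (π i) := by simp [hp]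
    rw [Equiv.Perm.mul_apply, this]
    simp [hH]
  have hπ : gaOf π = gaOf p⁻¹ * gaOf (p * π) := by
    rw [gaOf, gaOf, gaOf, ← map_mul, inv_mul_cancel_left]
  refine ⟨c * ((Equiv.Perm.sign (p * π) : ℤ) : ℂ), ?_⟩
  rw [mul_smul_comm, smul_mul_assoc, hπ, ← mul_assoc, rowSym_mul_of hp1, mul_assoc,
    of_mul_colAlt hq1, mul_smul_comm, smul_smul]

lemma youngSym_sandwich (x : GA n) :
    ∃ z : ℂ, youngSym μ * x * youngSym μ = z • youngSym μ := by
  obtain ⟨z, hz⟩ := rowSym_mul_colAlt_mem (μ := μ) (colAlt μ * x * rowSym μ)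
  exact ⟨z, by rw [← hz]; simp only [mul_assoc]⟩

lemma trace_mulRight_of (σ : Equiv.Perm (Fin n)) :
    LinearMap.trace ℂ (GA n) (LinearMap.mulRight ℂ (gaOf σ)) =
      if σ = 1 then (n.factorial : ℂ) else 0 := by
  rw [LinearMap.trace_eq_matrix_trace ℂ (MonoidAlgebra.basis (Equiv.Perm (Fin n)) ℂ),
    Matrix.trace]
  have : ∀ τ : Equiv.Perm (Fin n), (LinearMap.toMatrix (MonoidAlgebra.basis _ ℂ)
      (MonoidAlgebra.basis _ ℂ) (LinearMap.mulRight ℂ (gaOf σ))).diag τ =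
      if σ = 1 then 1 else 0 := by
    intro τ
    rw [Matrix.diag_apply, LinearMap.toMatrix_apply]
    simp [MonoidAlgebra.basis, MonoidAlgebra.single_mul_single, Finsupp.single_apply]
  rw [Finset.sum_congr rfl fun τ _ => this τ]
  by_cases h : σ = 1 <;> simp [h, Fintype.card_perm]

/-- Only the identity has nonzero trace in the regular representation. A permutation preserving all
rows and all columns is trivial, so the identity arises only from the pair `(1, 1)`. -/
lemma trace_mulRight_youngSym (μ : YD n) :
    LinearMap.trace ℂ (GA n) (LinearMap.mulRight ℂ (youngSym μ)) = (n.factorial : ℂ) := by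
  have hlin : ∀ x, LinearMap.trace ℂ (GA n) (LinearMap.mulRight ℂ x) =
      ((LinearMap.trace ℂ (GA n)) ∘ₗ (LinearMap.mul ℂ (GA n)).flip) x := fun x => rfl
  have hof : ∀ σ, ((LinearMap.trace ℂ (GA n)) ∘ₗ (LinearMap.mul ℂ (GA n)).flip) (gaOf σ) =
      if σ = 1 then (n.factorial : ℂ) else 0 := fun σ => trace_mulRight_of σ
  rw [hlin, youngSym, rowSym, colAlt, Finset.sum_mul_sum, map_sum]
  have : ∀ σ τ : Equiv.Perm (Fin n),
      ((LinearMap.trace ℂ (GA n)) ∘ₗ (LinearMap.mul ℂ (GA n)).flip)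
      ((if ∀ i, (filling μ (σ i)).1.1 = (filling μ i).1.1 then gaOf σ else 0) *
        (if ∀ i, (filling μ (τ i)).1.2 = (filling μ i).1.2 then
          ((Equiv.Perm.sign τ : ℤ) : ℂ) • gaOf τ else 0)) =
      if σ = 1 ∧ τ = 1 then (n.factorial : ℂ) else 0 := by
    intro σ τ
    by_cases h1 : ∀ i, (filling μ (σ i)).1.1 = (filling μ i).1.1
    swap
    · have : σ ≠ 1 := by rintro rfl; simp at h1
      rw [if_neg h1, zero_mul, map_zero, if_neg (by tauto)]
    by_cases h2 : ∀ i, (filling μ (τ i)).1.2 = (filling μ i).1.2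
    swap
    · have : τ ≠ 1 := by rintro rfl; simp at h2
      rw [if_neg h2, mul_zero, map_zero, if_neg (by tauto)]
    rw [if_pos h1, if_pos h2, mul_smul_comm, gaOf, gaOf, ← map_mul, map_smul, hof]
    by_cases h3 : σ * τ = 1
    · have hσ : σ = 1 := by
        ext i
        have e : τ (σ i) = i := by
          have : τ * σ = 1 := mul_eq_one_comm.1 h3
          simpa using DFunLike.congr_fun this i
        have e2 := h2 (σ i)
        rw [e] at e2
        have : filling μ (σ i) = filling μ i := Subtype.ext (Prod.ext (h1 i) e2.symm)
        simpa using congrArg Fin.val ((filling μ).injective this)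
      subst hσ
      have hτ : τ = 1 := by simpa using h3
      subst hτ
      simp
    · have : ¬ (σ = 1 ∧ τ = 1) := by rintro ⟨rfl, rfl⟩; simp at h3
      rw [if_neg h3, if_neg this, smul_zero]
  rw [Finset.sum_eq_single 1, map_sum, Finset.sum_eq_single 1]
  · rw [this]; simp
  · intro τ _ hτ
    rw [this, if_neg (by tauto)]
  · simp
  · intro σ _ hσ
    rw [map_sum]
    refine Finset.sum_eq_zero fun τ _ => ?_
    rw [this, if_neg (by tauto)]
  · simp

lemma youngSym_ne_zero (μ : YD n) : youngSym μ ≠ 0 := by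
  intro h
  have := trace_mulRight_youngSym μ
  rw [h, LinearMap.mulRight_zero_eq_zero, map_zero] at this
  exact Nat.cast_ne_zero.2 (Nat.factorial_ne_zero n) this.symm

/-- If the scalar were zero, right multiplication by the symmetrizer would be nilpotent and its
trace could not be `n!`. -/
lemma youngSym_sq (μ : YD n) : ∃ z : ℂ, z ≠ 0 ∧ youngSym μ * youngSym μ = z • youngSym μ := by
  obtain ⟨z, hz⟩ := youngSym_sandwich (μ := μ) 1
  rw [mul_one] at hz
  refine ⟨z, ?_, hz⟩
  rintro rfl
  rw [zero_smul] at hz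
  have hnil : IsNilpotent (LinearMap.mulRight ℂ (youngSym μ)) := by
    refine ⟨2, ?_⟩
    refine LinearMap.ext fun x => ?_
    rw [pow_two, Module.End.mul_apply, LinearMap.mulRight_apply, LinearMap.mulRight_apply,
      mul_assoc, hz, mul_zero, LinearMap.zero_apply]
  have := LinearMap.isNilpotent_trace_of_isNilpotent hnil
  rw [trace_mulRight_youngSym] at this
  exact Nat.cast_ne_zero.2 (Nat.factorial_ne_zero n) this.eq_zero

end Symmetrizers

/-! ### Schur's lemma and orthogonality -/

section Schur

variable {n : ℕ} {μ ν : YD n}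

/-- The Young symmetrizer as an element of the Specht module. -/
def spechtGen (μ : YD n) : Specht μ := ⟨youngSym μ, Ideal.subset_span rfl⟩

lemma exists_smul_spechtGen (v : Specht μ) : ∃ a : GA n, v = a • spechtGen μ := by
  obtain ⟨a, ha⟩ := Ideal.mem_span_singleton'.1 v.2
  exact ⟨a, Subtype.ext ha.symm⟩

lemma spechtGen_ne_zero (μ : YD n) : spechtGen μ ≠ 0 := fun h =>
  youngSym_ne_zero μ (congrArg Subtype.val h)

lemma dimIrr_pos (μ : YD n) : 0 < dimIrr μ := by
  have : Nontrivial (Specht μ) := ⟨⟨_, _, spechtGen_ne_zero μ⟩⟩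
  have : Module.Finite ℂ (Specht μ) :=
    inferInstanceAs (Module.Finite ℂ ((Specht μ).restrictScalars ℂ))
  exact Module.finrank_pos

lemma map_ga_smul {M : Type*} [AddCommGroup M] [Module ℂ M] (ρ : GA n →ₐ[ℂ] Module.End ℂ M)
    (f : Specht μ →ₗ[ℂ] M)
    (h : ∀ (σ : Equiv.Perm (Fin n)) v, f (gaOf σ • v) = ρ (gaOf σ) (f v)) (a : GA n)
    (v : Specht μ) : f (a • v) = ρ a (f v) := by
  refine ga_induction (P := fun a => f (a • v) = ρ a (f v)) (by simp) ?_ ?_ a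
  · intro x y hx hy
    rw [add_smul, map_add, hx, hy, map_add, LinearMap.add_apply]
  · intro c σ
    rw [smul_assoc, map_smul, h, map_smul, LinearMap.smul_apply]

lemma map_specht_smul (f : Specht ν →ₗ[ℂ] Specht μ)
    (h : ∀ (σ : Equiv.Perm (Fin n)) v, f (gaOf σ • v) = gaOf σ • f v) (a : GA n)
    (v : Specht ν) : f (a • v) = a • f v :=
  map_ga_smul (Algebra.lsmul ℂ ℂ (Specht μ)) f h a v

/-- The generator is an eigenvector of `youngSym ν` with nonzero eigenvalue, and an equivariant map
preserves this. Both forms of Schur's lemma thereby reduce to products with a symmetrizer on each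
side. -/
lemma exists_map_spechtGen (f : Specht ν →ₗ[ℂ] Specht μ)
    (h : ∀ (σ : Equiv.Perm (Fin n)) v, f (gaOf σ • v) = gaOf σ • f v) :
    ∃ y : GA n, (f (spechtGen ν) : GA n) = youngSym ν * y * youngSym μ := by
  obtain ⟨z, hz, hsq⟩ := youngSym_sq ν
  obtain ⟨a, ha⟩ := exists_smul_spechtGen (f (spechtGen ν))
  have h1 : youngSym ν • spechtGen ν = z • spechtGen ν := Subtype.ext hsq
  have h2 : f (spechtGen ν) = z⁻¹ • (youngSym ν • (a • spechtGen μ)) := by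
    rw [← ha, ← map_specht_smul f h, h1, map_smul, inv_smul_smul₀ hz]
  refine ⟨z⁻¹ • a, ?_⟩
  rw [h2]
  change z⁻¹ • (youngSym ν * (a * youngSym μ)) = _
  rw [mul_smul_comm, smul_mul_assoc, mul_assoc (youngSym ν)]

lemma schur_eq_zero (hne : μ ≠ ν) (f : Specht ν →ₗ[ℂ] Specht μ)
    (h : ∀ (σ : Equiv.Perm (Fin n)) v, f (gaOf σ • v) = gaOf σ • f v) : f = 0 := by
  obtain ⟨y, hy⟩ := exists_map_spechtGen f h
  rw [youngSym_mul_youngSym_ne hne.symm] at hy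
  ext1 v
  obtain ⟨a, rfl⟩ := exists_smul_spechtGen v
  rw [map_specht_smul f h, Subtype.ext (a2 := (0 : Specht μ)) hy, smul_zero,
    LinearMap.zero_apply]

lemma schur_scalar (f : Specht μ →ₗ[ℂ] Specht μ)
    (h : ∀ (σ : Equiv.Perm (Fin n)) v, f (gaOf σ • v) = gaOf σ • f v) :
    ∃ z : ℂ, ∀ v, f v = z • v := by
  obtain ⟨y, hy⟩ := exists_map_spechtGen f h
  obtain ⟨z, hz⟩ := youngSym_sandwich (μ := μ) y
  rw [hz] at hy
  refine ⟨z, fun v => ?_⟩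
  obtain ⟨a, rfl⟩ := exists_smul_spechtGen v
  have : f (spechtGen μ) = z • spechtGen μ := Subtype.ext hy
  rw [map_specht_smul f h, this, smul_comm]

variable {ι κ : Type} [Fintype ι] [Fintype κ]
  (b : Module.Basis ι ℂ (Specht μ)) (b' : Module.Basis κ ℂ (Specht ν))

lemma of_smul_basis (σ : Equiv.Perm (Fin n)) (j : ι) :
    gaOf σ • b j = ∑ i, matElt b σ i j • b i := (b.sum_repr _).symm

lemma matElt_one {ι : Type} (b : Module.Basis ι ℂ (Specht μ)) (i j : ι) :
    matElt b 1 i j = if i = j then 1 else 0 := by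
  simp only [matElt, map_one, one_smul, Module.Basis.repr_self, Finsupp.single_apply,
    eq_comm]

lemma matElt_mul (σ τ : Equiv.Perm (Fin n)) (i j : ι) :
    matElt b (σ * τ) i j = ∑ k, matElt b σ i k * matElt b τ k j := by
  have : gaOf (σ * τ) • b j = ∑ k, matElt b τ k j • (gaOf σ • b k) := by
    rw [gaOf, map_mul, mul_smul, of_smul_basis, Finset.smul_sum]
    exact Finset.sum_congr rfl fun k _ => smul_comm _ _ _
  change b.repr (gaOf (σ * τ) • b j) i = _
  rw [this, map_sum, Finsupp.finsetSum_apply]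
  refine Finset.sum_congr rfl fun k _ => ?_
  rw [map_smul, Finsupp.smul_apply, smul_eq_mul, mul_comm]
  rfl

lemma card_eq_dimIrr {ι : Type} [Fintype ι] (b : Module.Basis ι ℂ (Specht μ)) :
    Fintype.card ι = dimIrr μ := (Module.finrank_eq_card_basis b).symm

/-- A matrix that commutes with the two matrix representations defines an equivariant map. -/
lemma intertwiner_matrix (M : ι → κ → ℂ)
    (hM : ∀ σ i l, ∑ k, matElt b σ i k * M k l = ∑ k, M i k * matElt b' σ k l)
    (σ : Equiv.Perm (Fin n)) (v : Specht ν) :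
    b'.constr ℂ (fun l => ∑ i, M i l • b i) (gaOf σ • v) =
      gaOf σ • b'.constr ℂ (fun l => ∑ i, M i l • b i) v := by
  set f := b'.constr ℂ (fun l => ∑ i, M i l • b i) with hf
  have hfb : ∀ l, f (b' l) = ∑ i, M i l • b i := fun l => Module.Basis.constr_basis _ _ _ _
  have key : f ∘ₗ (Algebra.lsmul ℂ ℂ (Specht ν) (gaOf σ)) =
      (Algebra.lsmul ℂ ℂ (Specht μ) (gaOf σ)) ∘ₗ f := by
    refine b'.ext fun l => ?_
    simp only [LinearMap.comp_apply, Algebra.lsmul_coe]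
    rw [of_smul_basis, map_sum, hfb, Finset.smul_sum]
    simp_rw [map_smul, hfb, Finset.smul_sum, smul_comm (gaOf σ), of_smul_basis,
      Finset.smul_sum, smul_smul]
    rw [Finset.sum_comm]
    conv_rhs => rw [Finset.sum_comm]
    refine Finset.sum_congr rfl fun i _ => ?_
    rw [← Finset.sum_smul, ← Finset.sum_smul]
    congr 1
    calc _ = ∑ k, M i k * matElt b' σ k l := Finset.sum_congr rfl fun k _ => mul_comm _ _
      _ = _ := (hM σ i l).symm
      _ = _ := Finset.sum_congr rfl fun k _ => mul_comm _ _
  exact LinearMap.congr_fun key v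

/-- This is the group average of the elementary matrix `e_{jk}`, to which Schur's lemma is then
applied. -/
lemma avg_intertwines (j : ι) (k : κ) (σ : Equiv.Perm (Fin n)) (i : ι) (l : κ) :
    ∑ p, matElt b σ i p * ∑ τ, matElt b τ⁻¹ p j * matElt b' τ k l =
      ∑ q, (∑ τ, matElt b τ⁻¹ i j * matElt b' τ k q) * matElt b' σ q l := by
  simp_rw [Finset.mul_sum, Finset.sum_mul]
  rw [Finset.sum_comm]
  conv_rhs => rw [Finset.sum_comm]
  simp_rw [mul_assoc, ← Finset.mul_sum, ← matElt_mul, ← mul_assoc, ← Finset.sum_mul,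
    ← matElt_mul]
  refine Fintype.sum_equiv (Equiv.mulRight σ⁻¹) _ _ fun τ => ?_
  simp

lemma matElt_orthogonality_ne (hne : μ ≠ ν) (i j : ι) (k l : κ) :
    ∑ τ, matElt b τ⁻¹ i j * matElt b' τ k l = 0 := by
  set M : ι → κ → ℂ := fun i l => ∑ τ, matElt b τ⁻¹ i j * matElt b' τ k l with hM
  have h0 := schur_eq_zero hne _
    (intertwiner_matrix b b' M fun σ i l => avg_intertwines b b' j k σ i l)
  have h1 := LinearMap.congr_fun h0 (b' l)
  rw [Module.Basis.constr_basis, LinearMap.zero_apply] at h1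
  exact Fintype.linearIndependent_iff.1 b.linearIndependent _ h1 i

lemma matElt_orthogonality (i j k l : ι) :
    ∑ τ, matElt b τ⁻¹ i j * matElt b τ k l =
      if i = l ∧ j = k then (n.factorial : ℂ) / (dimIrr μ : ℂ) else 0 := by
  set M : ι → ι → ℂ := fun i l => ∑ τ, matElt b τ⁻¹ i j * matElt b τ k l with hM
  obtain ⟨z, hz⟩ := schur_scalar _
    (intertwiner_matrix b b M fun σ i l => avg_intertwines b b j k σ i l)
  have hMz : ∀ i l, M i l = if i = l then z else 0 := by
    intro i l
    have h1 := hz (b l)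
    rw [Module.Basis.constr_basis] at h1
    have h2 := DFunLike.congr_fun (congrArg b.repr h1) i
    simpa [Finsupp.single_apply, eq_comm] using h2
  -- Each conjugate of `e_{jk}` has trace `δ_{jk}`; dividing the total by the dimension fixes the
  -- Schur scalar.
  have htr : ∑ p, M p p = if j = k then (n.factorial : ℂ) else 0 := by
    simp only [hM]
    rw [Finset.sum_comm]
    have : ∀ τ : Equiv.Perm (Fin n),
        ∑ p, matElt b τ⁻¹ p j * matElt b τ k p = if j = k then 1 else 0 := by
      intro τ
      have := matElt_mul b τ τ⁻¹ k j
      rw [mul_inv_cancel, matElt_one] at this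
      rw [eq_comm (a := j), this]
      exact Finset.sum_congr rfl fun p _ => mul_comm _ _
    rw [Finset.sum_congr rfl fun τ _ => this τ, Finset.sum_const, Finset.card_univ,
      Fintype.card_perm, Fintype.card_fin]
    simp
  simp_rw [hMz, if_true, Finset.sum_const, Finset.card_univ, card_eq_dimIrr b] at htr
  have hd : (dimIrr μ : ℂ) ≠ 0 := Nat.cast_ne_zero.2 (dimIrr_pos μ).ne'
  change M i l = _
  rw [hMz]
  have hzv : z = if j = k then (n.factorial : ℂ) / (dimIrr μ : ℂ) else 0 := by
    rw [nsmul_eq_mul] at htr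
    rw [eq_comm, ← mul_right_inj' hd, htr]
    split_ifs
    · field_simp
    · simp
  by_cases h1 : i = l <;> by_cases h2 : j = k <;> simp [h1, h2, hzv]

end Schur

/-! ### Completeness of the Specht modules -/

section Completeness

variable {n : ℕ}

lemma card_ofRowLens (w : List ℕ) (hw : w.SortedGE) (hpos : ∀ x ∈ w, 0 < x) :
    (YoungDiagram.ofRowLens w hw).card = w.sum := by
  set μ := YoungDiagram.ofRowLens w hw with hμ
  have h1 : μ.rowLens = w := YoungDiagram.rowLens_ofRowLens_eq_self hpos
  conv_rhs => rw [← h1]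
  have hmaps : ∀ c ∈ μ.cells, c.1 ∈ Finset.range (μ.colLen 0) := fun c hc => by
    rw [Finset.mem_range, ← YoungDiagram.mem_iff_lt_colLen]
    exact μ.up_left_mem le_rfl (Nat.zero_le _) hc
  rw [YoungDiagram.card, Finset.card_eq_sum_card_fiberwise hmaps, YoungDiagram.rowLens]
  change _ = ∑ i ∈ Finset.range (μ.colLen 0), μ.rowLen i
  refine Finset.sum_congr rfl fun i _ => ?_
  rw [YoungDiagram.rowLen_eq_card]
  rfl

/-- The Young diagram of a partition. -/
def ydOfPartition {m : ℕ} (p : m.Partition) : YD m :=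
  ⟨YoungDiagram.ofRowLens (p.parts.sort (· ≥ ·)) ((Multiset.pairwise_sort _ _).sortedGE), by
    rw [card_ofRowLens _ _ fun x hx => p.parts_pos ((Multiset.mem_sort _).1 hx)]
    rw [← Multiset.sum_coe, Multiset.sort_eq, p.parts_sum]⟩

lemma ydOfPartition_injective {m : ℕ} :
    Function.Injective (ydOfPartition : m.Partition → YD m) := by
  intro p q h
  have h1 := congrArg (fun μ : YD m => μ.1.rowLens) h
  simp only [ydOfPartition] at h1
  rw [YoungDiagram.rowLens_ofRowLens_eq_self
      fun x hx => p.parts_pos ((Multiset.mem_sort _).1 hx),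
    YoungDiagram.rowLens_ofRowLens_eq_self
      fun x hx => q.parts_pos ((Multiset.mem_sort _).1 hx)] at h1
  have h2 := congrArg (fun l : List ℕ => (l : Multiset ℕ)) h1
  simp only [Multiset.sort_eq] at h2
  exact Nat.Partition.ext h2

instance finite_le_youngDiagram (μ : YoungDiagram) : Finite {ν : YoungDiagram // ν ≤ μ} :=
  Finite.of_injective (β := μ.cells.powerset)
    (fun ν => ⟨ν.1.cells, Finset.mem_powerset.2 (YoungDiagram.cells_subset_iff.2 ν.2)⟩)
    fun _ _ h => Subtype.ext (YoungDiagram.ext (congrArg Subtype.val h))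

instance finite_yd (n : ℕ) : Finite (YD n) := by
  refine Finite.of_injective
    (β := (Finset.range n ×ˢ Finset.range n).powerset)
    (fun μ => ⟨μ.1.cells, Finset.mem_powerset.2 fun c hc => ?_⟩)
    fun _ _ h => Subtype.ext (YoungDiagram.ext (congrArg Subtype.val h))
  have hcard := μ.2
  have hc' : (c.1, c.2) ∈ μ.1 := hc
  rw [Finset.mem_product, Finset.mem_range, Finset.mem_range]
  constructor
  · have h1 := YoungDiagram.mem_iff_lt_colLen.1 hc'
    rw [YoungDiagram.colLen_eq_card] at h1
    exact h1.trans_le ((Finset.card_le_card (Finset.filter_subset _ _)).trans hcard.le)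
  · have h1 := YoungDiagram.mem_iff_lt_rowLen.1 hc'
    rw [YoungDiagram.rowLen_eq_card] at h1
    exact h1.trans_le ((Finset.card_le_card (Finset.filter_subset _ _)).trans hcard.le)

instance fintypeYD (n : ℕ) : Fintype (YD n) := Fintype.ofFinite _

/-- Conjugacy classes embed into partitions by cycle type, and partitions embed into diagrams. This
inequality suffices, because the independence of the characters gives the reverse one. -/
lemma card_conjClasses_le (n : ℕ) :
    Fintype.card (ConjClasses (Equiv.Perm (Fin n))) ≤ Fintype.card (YD n) := by
  let f : ConjClasses (Equiv.Perm (Fin n)) → (Fintype.card (Fin n)).Partition :=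
    Quotient.lift Equiv.Perm.partition fun σ τ h => Equiv.Perm.partition_eq_of_isConj.1 h
  have hf : Function.Injective f := by
    intro x y
    induction x using Quotient.inductionOn
    induction y using Quotient.inductionOn
    intro h
    exact Quotient.sound (Equiv.Perm.partition_eq_of_isConj.2 h)
  have h1 := Fintype.card_le_of_injective _ (ydOfPartition_injective.comp hf)
  rwa [Fintype.card_fin] at h1

variable {ι : YD n → Type} [∀ μ, Fintype (ι μ)] (b : ∀ μ, Module.Basis (ι μ) ℂ (Specht μ))

lemma character_conj {μ : YD n} {κ : Type} [Fintype κ] (b : Module.Basis κ ℂ (Specht μ))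
    {σ τ : Equiv.Perm (Fin n)} (h : IsConj σ τ) :
    ∑ i, matElt b σ i i = ∑ i, matElt b τ i i := by
  obtain ⟨c, rfl⟩ := isConj_iff.1 h
  have : ∀ i, matElt b (c * σ * c⁻¹) i i =
      ∑ p, ∑ q, matElt b c i p * matElt b σ p q * matElt b c⁻¹ q i := by
    intro i
    rw [matElt_mul, Finset.sum_comm]
    refine Finset.sum_congr rfl fun q _ => ?_
    rw [matElt_mul, Finset.sum_mul]
  simp_rw [this]
  rw [Finset.sum_comm]
  refine Finset.sum_congr rfl fun p _ => ?_
  rw [Finset.sum_comm]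
  have h2 : ∀ q, ∑ i, matElt b c i p * matElt b σ p q * matElt b c⁻¹ q i =
      matElt b σ p q * if q = p then 1 else 0 := by
    intro q
    rw [← matElt_one b, ← inv_mul_cancel c, matElt_mul, Finset.mul_sum]
    exact Finset.sum_congr rfl fun i _ => by ring
  simp [h2]

/-- The character of a Specht module as a function on conjugacy classes. -/
def charClass (μ : YD n) : ConjClasses (Equiv.Perm (Fin n)) → ℂ :=
  Quotient.lift (fun σ => ∑ i, matElt (b μ) σ i i) fun _ _ h => character_conj (b μ) h

lemma charClass_mk (μ : YD n) (σ : Equiv.Perm (Fin n)) :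
    charClass b μ (ConjClasses.mk σ) = ∑ i, matElt (b μ) σ i i := rfl

lemma character_orthogonality (μ ν : YD n) :
    ∑ τ, charClass b μ (ConjClasses.mk τ⁻¹) * charClass b ν (ConjClasses.mk τ) =
      if μ = ν then (n.factorial : ℂ) else 0 := by
  simp_rw [charClass_mk, Finset.sum_mul_sum]
  rw [Finset.sum_comm]
  have h1 : ∀ i, ∑ τ : Equiv.Perm (Fin n), ∑ j, matElt (b μ) τ⁻¹ i i * matElt (b ν) τ j j =
      ∑ j, ∑ τ : Equiv.Perm (Fin n), matElt (b μ) τ⁻¹ i i * matElt (b ν) τ j j :=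
    fun i => Finset.sum_comm
  simp_rw [h1]
  by_cases h : μ = ν
  · subst h
    simp_rw [matElt_orthogonality]
    have hd : (dimIrr μ : ℂ) ≠ 0 := Nat.cast_ne_zero.2 (dimIrr_pos μ).ne'
    simp [card_eq_dimIrr (b μ), mul_div_cancel₀ _ hd]
  · simp_rw [matElt_orthogonality_ne (b μ) (b ν) h, if_neg h]
    simp

lemma linearIndependent_charClass : LinearIndependent ℂ (charClass b) := by
  rw [Fintype.linearIndependent_iff]
  intro g hg ν
  have h1 : ∑ τ, charClass b ν (ConjClasses.mk τ⁻¹) *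
      (∑ μ, g μ • charClass b μ) (ConjClasses.mk τ) = g ν * n.factorial := by
    simp_rw [Finset.sum_apply, Pi.smul_apply, smul_eq_mul, Finset.mul_sum]
    rw [Finset.sum_comm]
    simp_rw [mul_left_comm, ← Finset.mul_sum, character_orthogonality]
    simp
  rw [hg] at h1
  simp only [Pi.zero_apply, mul_zero, Finset.sum_const_zero] at h1
  exact (mul_eq_zero.1 h1.symm).resolve_right (Nat.cast_ne_zero.2 (Nat.factorial_ne_zero n))

/-- The regular character: `∑_μ d_μ χ_μ = n! δ_1`. -/
lemma sum_dimIrr_mul_matElt (σ : Equiv.Perm (Fin n)) :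
    ∑ μ, (dimIrr μ : ℂ) * ∑ i, matElt (b μ) σ i i = if σ = 1 then (n.factorial : ℂ) else 0 := by
  -- The two bounds on the number of diagrams meet, so the characters form a basis of the class
  -- functions and the indicator of the identity can be expanded in them.
  have hcard : Fintype.card (YD n) =
      Module.finrank ℂ (ConjClasses (Equiv.Perm (Fin n)) → ℂ) := by
    refine le_antisymm (linearIndependent_charClass b).fintype_card_le_finrank ?_
    rw [Module.finrank_fintype_fun_eq_card]
    exact card_conjClasses_le n
  have hspan := (linearIndependent_charClass b).span_eq_top_of_card_eq_finrank' hcard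
  let δ : ConjClasses (Equiv.Perm (Fin n)) → ℂ :=
    fun c => if c = ConjClasses.mk 1 then (n.factorial : ℂ) else 0
  have hδ : δ ∈ Submodule.span ℂ (Set.range (charClass b)) := hspan ▸ Submodule.mem_top
  obtain ⟨g, hg⟩ := (Submodule.mem_span_range_iff_exists_fun ℂ).1 hδ
  have hmk : ∀ τ : Equiv.Perm (Fin n), ConjClasses.mk τ = ConjClasses.mk 1 ↔ τ = 1 := by
    intro τ
    rw [ConjClasses.mk_eq_mk_iff_isConj, isConj_comm]
    exact isConj_one_right
  -- Orthogonality reads off the coefficient as the character value at the identity.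
  have hgd : ∀ ν, g ν = dimIrr ν := by
    intro ν
    have h1 : ∑ τ, charClass b ν (ConjClasses.mk τ⁻¹) *
        (∑ μ, g μ • charClass b μ) (ConjClasses.mk τ) = g ν * n.factorial := by
      simp_rw [Finset.sum_apply, Pi.smul_apply, smul_eq_mul, Finset.mul_sum]
      rw [Finset.sum_comm]
      simp_rw [mul_left_comm, ← Finset.mul_sum, character_orthogonality]
      simp
    rw [hg] at h1
    simp only [δ, hmk, mul_ite, mul_zero, Finset.sum_ite_eq', Finset.mem_univ, if_true, inv_one,
      charClass_mk, matElt_one, Finset.sum_const, Finset.card_univ, card_eq_dimIrr (b ν),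
      nsmul_eq_mul, mul_one] at h1
    exact (mul_right_cancel₀ (Nat.cast_ne_zero.2 (Nat.factorial_ne_zero n)) h1).symm
  have := congrFun hg (ConjClasses.mk σ)
  simp only [δ, hmk, Finset.sum_apply, Pi.smul_apply, smul_eq_mul, hgd, charClass_mk] at this
  exact this

end Completeness

instance finite_specht {n : ℕ} (μ : YD n) : Module.Finite ℂ (Specht μ) :=
  inferInstanceAs (Module.Finite ℂ ((Specht μ).restrictScalars ℂ))

/-! ### Matrix units in an algebra with an action of `S(n)` -/

section MatrixUnits

variable {n : ℕ} {μ ν : YD n} {ι κ : Type} [Fintype ι] [Fintype κ]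
  (b : Module.Basis ι ℂ (Specht μ)) (b' : Module.Basis κ ℂ (Specht ν))

/-- Here and in `avg_smul_same` the family `X` lives in any module, so that the equal-irrep case
serves both operator products and the action on vectors. -/
lemma avg_smul_ne {M : Type*} [AddCommGroup M] [Module ℂ M] (hne : μ ≠ ν) (X : κ → M) (i j : ι)
    (k : κ) : ((dimIrr μ : ℂ) / (n.factorial : ℂ)) •
      ∑ τ : Equiv.Perm (Fin n), matElt b τ⁻¹ j i • ∑ p, matElt b' τ p k • X p = 0 := by
  simp_rw [Finset.smul_sum (N := M), smul_smul]
  rw [Finset.sum_comm]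
  refine Finset.sum_eq_zero fun p _ => ?_
  rw [← Finset.sum_smul]
  simp_rw [← Finset.mul_sum]
  rw [Finset.sum_congr rfl fun τ _ => mul_comm (matElt b τ⁻¹ j i) (matElt b' τ p k)]
  have := matElt_orthogonality_ne b b' hne j i p k
  simp_rw [mul_comm (matElt b _ j i)] at this
  rw [this, mul_zero, zero_smul]

lemma avg_smul_same {M : Type*} [AddCommGroup M] [Module ℂ M] (X : ι → M) (i j k : ι) :
    ((dimIrr μ : ℂ) / (n.factorial : ℂ)) •
      ∑ τ : Equiv.Perm (Fin n), matElt b τ⁻¹ j i • ∑ p, matElt b τ p k • X p =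
    if j = k then X i else 0 := by
  have hd : (dimIrr μ : ℂ) ≠ 0 := Nat.cast_ne_zero.2 (dimIrr_pos μ).ne'
  have hn : (n.factorial : ℂ) ≠ 0 := Nat.cast_ne_zero.2 (Nat.factorial_ne_zero n)
  simp_rw [Finset.smul_sum (N := M), smul_smul]
  rw [Finset.sum_comm]
  simp_rw [← Finset.sum_smul, ← Finset.mul_sum, matElt_orthogonality]
  rw [Finset.sum_eq_single i]
  · by_cases h : j = k
    · rw [if_pos ⟨h, rfl⟩, if_pos h, div_mul_div_cancel₀ hn, div_self hd, one_smul]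
    · rw [if_neg (fun h' => h h'.1), if_neg h, mul_zero, zero_smul]
  · intro p _ hp
    rw [if_neg (fun h' => hp h'.2.symm), mul_zero, zero_smul]
  · simp

variable {A : Type*} [Ring A] [Algebra ℂ A] (ρ : Equiv.Perm (Fin n) →* A)

/-- The matrix unit `E_{ij} = (d_μ / n!) ∑_τ φ_{ji}(τ⁻¹) ρ(τ)`. -/
def matUnit (i j : ι) : A :=
  ((dimIrr μ : ℂ) / (n.factorial : ℂ)) •
    ∑ τ : Equiv.Perm (Fin n), matElt b τ⁻¹ j i • ρ τ

lemma mul_matUnit (σ : Equiv.Perm (Fin n)) (i j : ι) :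
    ρ σ * matUnit b ρ i j = ∑ k, matElt b σ k i • matUnit b ρ k j := by
  unfold matUnit
  simp_rw [mul_smul_comm, smul_comm (matElt b σ _ i), ← Finset.smul_sum]
  congr 1
  simp_rw [Finset.mul_sum, Finset.smul_sum]
  rw [Finset.sum_comm]
  refine Fintype.sum_equiv (Equiv.mulLeft σ) _ _ fun τ => ?_
  simp_rw [smul_smul, ← Finset.sum_smul, Equiv.coe_mulLeft, mul_smul_comm, ← map_mul]
  congr 1
  have : τ⁻¹ = (σ * τ)⁻¹ * σ := by group
  rw [this, matElt_mul]
  exact Finset.sum_congr rfl fun k _ => mul_comm _ _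

lemma matUnit_mul_of (σ : Equiv.Perm (Fin n)) (i j : ι) :
    matUnit b ρ i j * ρ σ = ∑ k, matElt b σ j k • matUnit b ρ i k := by
  unfold matUnit
  simp_rw [smul_mul_assoc, smul_comm (matElt b σ j _), ← Finset.smul_sum]
  congr 1
  simp_rw [Finset.sum_mul, Finset.smul_sum]
  rw [Finset.sum_comm]
  refine Fintype.sum_equiv (Equiv.mulRight σ) _ _ fun τ => ?_
  simp_rw [smul_smul, ← Finset.sum_smul, Equiv.coe_mulRight, smul_mul_assoc, ← map_mul]
  congr 1
  have : τ⁻¹ = σ * (τ * σ)⁻¹ := by group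
  rw [this, matElt_mul]

/-- A family that transforms like a basis of another irrep is annihilated. -/
lemma matUnit_mul_eq_zero (hne : μ ≠ ν) (X : κ → A)
    (hX : ∀ σ k, ρ σ * X k = ∑ p, matElt b' σ p k • X p) (i j : ι) (k : κ) :
    matUnit b ρ i j * X k = 0 := by
  rw [← avg_smul_ne b b' hne X i j k, matUnit, smul_mul_assoc, Finset.sum_mul]
  simp_rw [smul_mul_assoc, hX]

lemma matUnit_mul_same (X : ι → A)
    (hX : ∀ σ k, ρ σ * X k = ∑ p, matElt b σ p k • X p) (i j k : ι) :
    matUnit b ρ i j * X k = if j = k then X i else 0 := by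
  rw [← avg_smul_same b X i j k, matUnit, smul_mul_assoc, Finset.sum_mul]
  simp_rw [smul_mul_assoc, hX]

lemma mul_matUnit_same (X : ι → A)
    (hX : ∀ σ k, X k * ρ σ = ∑ p, matElt b σ k p • X p) (i j k : ι) :
    X k * matUnit b ρ i j = if k = i then X j else 0 := by
  have hd : (dimIrr μ : ℂ) ≠ 0 := Nat.cast_ne_zero.2 (dimIrr_pos μ).ne'
  have hn : (n.factorial : ℂ) ≠ 0 := Nat.cast_ne_zero.2 (Nat.factorial_ne_zero n)
  rw [matUnit, mul_smul_comm, Finset.mul_sum]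
  simp_rw [mul_smul_comm, hX, Finset.smul_sum, smul_smul]
  rw [Finset.sum_comm]
  simp_rw [← Finset.sum_smul, ← Finset.mul_sum, matElt_orthogonality]
  rw [Finset.sum_eq_single j]
  · by_cases h : k = i
    · rw [if_pos ⟨rfl, h.symm⟩, if_pos h, div_mul_div_cancel₀ hn, div_self hd, one_smul]
    · rw [if_neg (fun h' => h h'.2.symm), if_neg h, mul_zero, zero_smul]
  · intro p _ hp
    rw [if_neg (fun h' => hp h'.1.symm), mul_zero, zero_smul]
  · simp

lemma matUnit_mul_matUnit_ne (hne : μ ≠ ν) (i j : ι) (k l : κ) :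
    matUnit b ρ i j * matUnit b' ρ k l = 0 :=
  matUnit_mul_eq_zero b b' ρ hne (fun k => matUnit b' ρ k l)
    (fun σ k => mul_matUnit b' ρ σ k l) i j k

lemma matUnit_mul_matUnit (i j k l : ι) :
    matUnit b ρ i j * matUnit b ρ k l = if j = k then matUnit b ρ i l else 0 :=
  matUnit_mul_same b ρ (fun k => matUnit b ρ k l) (fun σ k => mul_matUnit b ρ σ k l) i j k

/-- The regular character formula removes every permutation except the identity from the sum. -/
lemma sum_matUnit_self {ι : YD n → Type} [∀ μ, Fintype (ι μ)]
    (b : ∀ μ, Module.Basis (ι μ) ℂ (Specht μ)) :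
    ∑ μ, ∑ i, matUnit (b μ) ρ i i = 1 := by
  have hn : (n.factorial : ℂ) ≠ 0 := Nat.cast_ne_zero.2 (Nat.factorial_ne_zero n)
  have h1 : ∀ μ, ∑ i, matUnit (b μ) ρ i i = (n.factorial : ℂ)⁻¹ •
      ∑ τ : Equiv.Perm (Fin n), ((dimIrr μ : ℂ) * ∑ i, matElt (b μ) τ⁻¹ i i) • ρ τ := by
    intro μ
    simp_rw [matUnit, div_eq_inv_mul, mul_smul]
    rw [← Finset.smul_sum, ← Finset.smul_sum, Finset.sum_comm, Finset.smul_sum]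
    simp_rw [Finset.sum_smul]
  simp_rw [h1]
  rw [← Finset.smul_sum, Finset.sum_comm]
  simp_rw [← Finset.sum_smul, sum_dimIrr_mul_matElt b, inv_eq_one, ite_smul, zero_smul]
  rw [Finset.sum_ite_eq' Finset.univ (1 : Equiv.Perm (Fin n)), if_pos (Finset.mem_univ _),
    smul_smul, inv_mul_cancel₀ hn, one_smul, map_one]

/-- A family that transforms like the basis extends to an equivariant map. -/
lemma constr_equivariant {M : Type*} [AddCommGroup M] [Module ℂ M]
    (T : Equiv.Perm (Fin n) → M →ₗ[ℂ] M) (X : ι → M)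
    (hX : ∀ σ k, T σ (X k) = ∑ p, matElt b σ p k • X p) (σ : Equiv.Perm (Fin n)) (v : Specht μ) :
    b.constr ℂ X (gaOf σ • v) = T σ (b.constr ℂ X v) := by
  have key : b.constr ℂ X ∘ₗ (Algebra.lsmul ℂ ℂ (Specht μ) (gaOf σ)) =
      T σ ∘ₗ b.constr ℂ X := by
    refine b.ext fun l => ?_
    simp only [LinearMap.comp_apply, Algebra.lsmul_coe]
    rw [of_smul_basis, map_sum, Module.Basis.constr_basis, hX]
    simp_rw [map_smul, Module.Basis.constr_basis]
  exact LinearMap.congr_fun key v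

/-- A column of matrix units is an equivariant image of the Specht module. On the target `youngSym
μ` acts by zero, on the generator by a nonzero scalar, so the map vanishes. -/
lemma matUnit_eq_zero (h : MonoidAlgebra.lift ℂ A _ ρ (colAlt μ) = 0) (i j : ι) :
    matUnit b ρ i j = 0 := by
  set L := MonoidAlgebra.lift ℂ A _ ρ with hL
  have hLof : ∀ σ, L (gaOf σ) = ρ σ := fun σ => by simp [hL]
  set f := b.constr ℂ (fun k => matUnit b ρ k j) with hf
  have hf1 : ∀ (σ : Equiv.Perm (Fin n)) v,
      f (gaOf σ • v) = ((Algebra.lmul ℂ A).comp L) (gaOf σ) (f v) := by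
    intro σ v
    refine (constr_equivariant b (fun σ => LinearMap.mulLeft ℂ (ρ σ)) _
      (fun σ k => mul_matUnit b ρ σ k j) σ v).trans ?_
    rw [AlgHom.comp_apply, hLof]
    rfl
  have hf2 := map_ga_smul ((Algebra.lmul ℂ A).comp L) f hf1
  obtain ⟨z, hz, hsq⟩ := youngSym_sq μ
  have h1 : youngSym μ • spechtGen μ = z • spechtGen μ := Subtype.ext hsq
  have h2 : f (spechtGen μ) = 0 := by
    have h3 := hf2 (youngSym μ) (spechtGen μ)
    have h4 : L (youngSym μ) = 0 := by rw [youngSym, map_mul, h, mul_zero]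
    rw [h1, map_smul, AlgHom.comp_apply, h4, map_zero, LinearMap.zero_apply] at h3
    exact (smul_eq_zero.1 h3).resolve_left hz
  have h5 : f (b i) = 0 := by
    obtain ⟨a, ha⟩ := exists_smul_spechtGen (b i)
    rw [ha, hf2, h2, map_zero]
  rwa [hf, Module.Basis.constr_basis] at h5

end MatrixUnits

/-! ### Permutation operators and multiplicities -/

section PermOps

variable {d n : ℕ}

lemma permOp_mul_apply (σ : Equiv.Perm (Fin n)) (A : Op d n) (y x) :
    (permOp d σ * A) y x = A (y ∘ σ) x := by
  rw [Matrix.mul_apply, Finset.sum_eq_single (y ∘ σ)]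
  · have : y = (y ∘ σ) ∘ ⇑σ⁻¹ := by ext i; simp
    simp only [permOp, Matrix.of_apply, ← this, if_true, one_mul]
  · intro z _ hz
    have : y ≠ z ∘ ⇑σ⁻¹ := by rintro rfl; exact hz (by ext i; simp)
    simp only [permOp, Matrix.of_apply, if_neg this, zero_mul]
  · simp

lemma mul_permOp_apply (σ : Equiv.Perm (Fin n)) (A : Op d n) (y x) :
    (A * permOp d σ) y x = A y (x ∘ ⇑σ⁻¹) := by
  rw [Matrix.mul_apply, Finset.sum_eq_single (x ∘ ⇑σ⁻¹)]
  · simp only [permOp, Matrix.of_apply, if_true, mul_one]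
  · intro z _ hz
    simp only [permOp, Matrix.of_apply, if_neg hz, mul_zero]
  · simp

lemma permOp_mul (σ τ : Equiv.Perm (Fin n)) : permOp d (σ * τ) = permOp d σ * permOp d τ := by
  ext y x
  rw [mul_permOp_apply]
  simp only [permOp, Matrix.of_apply, mul_inv_rev, Equiv.Perm.coe_mul]
  rfl

lemma permOp_one : permOp d (1 : Equiv.Perm (Fin n)) = 1 := by
  ext y x
  simp [permOp, Matrix.one_apply]

/-- The permutation representation of `S(n)` on `(ℂ^d)^{⊗ n}`. -/
def permOpHom (d n : ℕ) : Equiv.Perm (Fin n) →* Op d n where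
  toFun := permOp d
  map_one' := permOp_one
  map_mul' := permOp_mul

lemma permOp_conjTranspose (σ : Equiv.Perm (Fin n)) : (permOp d σ)ᴴ = permOp d σ⁻¹ := by
  ext y x
  have : x = y ∘ ⇑σ⁻¹ ↔ y = x ∘ ⇑(σ⁻¹)⁻¹ := by
    constructor <;> (rintro rfl; ext i; simp)
  simp only [permOp, Matrix.conjTranspose_apply, Matrix.of_apply, this]
  split_ifs <;> simp

lemma emb_castLE {m n : ℕ} (h : m ≤ n) (σ : Equiv.Perm (Fin m)) (i : Fin m) :
    emb h σ (Fin.castLE h i) = Fin.castLE h (σ i) :=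
  Equiv.Perm.viaEmbedding_apply σ (Fin.castLEEmb h) i

lemma emb_of_le {m n : ℕ} (h : m ≤ n) (σ : Equiv.Perm (Fin m)) (i : Fin n) (hi : m ≤ i) :
    emb h σ i = i := by
  refine Equiv.Perm.viaEmbedding_apply_of_notMem σ (Fin.castLEEmb h) i ?_
  rintro ⟨j, rfl⟩
  have := j.2
  simp at hi
  omega

/-- By pigeonhole two positions of the first column carry the same basis state. Exchanging them
fixes the basis vector but changes the sign of the antisymmetrizer. -/
lemma lift_colAlt_eq_zero {m : ℕ} (h : m ≤ n) {μ : YD m} (hμ : d < μ.1.colLen 0) :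
    MonoidAlgebra.lift ℂ (Op d n) _ ((permOpHom d n).comp (emb h)) (colAlt μ) = 0 := by
  set L := MonoidAlgebra.lift ℂ (Op d n) _ ((permOpHom d n).comp (emb h)) with hL
  ext y x
  let c : Fin (μ.1.colLen 0) → Fin m := fun r =>
    (filling μ).symm ⟨(r, 0), YoungDiagram.mem_iff_lt_colLen.2 r.2⟩
  have hc : ∀ r, (filling μ (c r)).1 = (↑r, 0) := fun r => by simp [c]
  obtain ⟨r, s, hrs, hx⟩ := Fintype.exists_ne_map_eq_of_card_lt
    (fun r => x (Fin.castLE h (c r))) (by simpa using hμ)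
  have hne : c r ≠ c s := fun e => hrs (by
    have := congrArg Prod.fst ((hc r).symm.trans ((congrArg _ (by rw [e])).trans (hc s)))
    exact Fin.ext this)
  set t := Equiv.swap (c r) (c s) with ht
  have h1 := colAlt_mul_of (μ := μ) (σ := t)
    (swap_preserves (f := fun k => (filling μ k).1.2) (by rw [hc, hc]))
  rw [ht, Equiv.Perm.sign_swap hne, ← ht] at h1
  have h2 := congrArg L h1
  have hLof : L (gaOf t) = permOp d (emb h t) := by simp [hL, permOpHom]
  rw [map_mul, hLof, map_smul] at h2
  have h3 := congrFun (congrFun h2 y) x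
  rw [mul_permOp_apply] at h3
  have h4 : x ∘ ⇑(emb h t)⁻¹ = x := by
    rw [← map_inv, ht, Equiv.swap_inv]
    ext i
    by_cases hi : (i : ℕ) < m
    · have : i = Fin.castLE h ⟨i, hi⟩ := rfl
      rw [this, Function.comp_apply, emb_castLE]
      exact congrArg _ (swap_preserves (f := fun k => x (Fin.castLE h k)) hx _)
    · rw [Function.comp_apply, emb_of_le h _ i (not_lt.1 hi)]
  rw [h4] at h3
  refine self_eq_neg_complex (M := ℂ) ?_
  simpa using h3

lemma mem_intertwiners {μ : YD n} (f : Specht μ →ₗ[ℂ] ((Fin n → Fin d) → ℂ)) :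
    f ∈ intertwiners d μ ↔ ∀ (σ : Equiv.Perm (Fin n)) (v : Specht μ),
      f (gaOf σ • v) = permOp d σ *ᵥ f v := Iff.rfl

/-- A nonzero intertwiner comes from letting the Specht module act on the basis vector in which each
tensor factor carries the row number of its box. -/
lemma mult_ne_zero {μ : YD n} (hμ : μ.1.colLen 0 ≤ d) : mult d μ ≠ 0 := by
  set L := MonoidAlgebra.lift ℂ (Op d n) _ (permOpHom d n) with hL
  have hLof : ∀ σ, L (gaOf σ) = permOp d σ := fun σ => by simp [hL, permOpHom]
  let row : Fin n → Fin d := fun i => ⟨(filling μ i).1.1, by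
    have : ((filling μ i).1.1, (filling μ i).1.2) ∈ μ.1 := (filling μ i).2
    have := μ.1.up_left_mem le_rfl (Nat.zero_le _) this
    exact (YoungDiagram.mem_iff_lt_colLen.1 this).trans_le hμ⟩
  let v : (Fin n → Fin d) → ℂ := Pi.single row 1
  let f : Specht μ →ₗ[ℂ] ((Fin n → Fin d) → ℂ) :=
    { toFun := fun x => L x.1 *ᵥ v
      map_add' := fun x y => by
        rw [Submodule.coe_add, map_add, Matrix.add_mulVec]
      map_smul' := fun c x => by
        rw [Submodule.coe_smul_of_tower, map_smul, Matrix.smul_mulVec, RingHom.id_apply] }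
  have hf : f ∈ intertwiners d μ := by
    rw [mem_intertwiners]
    intro σ x
    change L (gaOf σ * x.1) *ᵥ v = permOp d σ *ᵥ (L x.1 *ᵥ v)
    rw [map_mul, hLof, Matrix.mulVec_mulVec]
  -- A column-preserving permutation that fixes the word of row numbers also preserves rows, hence
  -- is the identity.
  have hb : L (colAlt μ) row row = 1 := by
    rw [colAlt, map_sum, Matrix.sum_apply, Finset.sum_eq_single 1]
    · simp only [Equiv.Perm.coe_one, id_eq, implies_true, if_true, map_smul, hLof, permOp_one]
      simp
    · intro σ _ hσ
      split_ifs with h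
      · rw [map_smul, hLof]
        simp only [Matrix.smul_apply, permOp, Matrix.of_apply]
        rw [if_neg, smul_zero]
        intro hr
        apply hσ
        ext i
        have h1 := congrArg Fin.val (congrFun hr (σ i))
        simp only [row, Function.comp_apply, Equiv.Perm.coe_inv, Equiv.symm_apply_apply] at h1
        have : filling μ (σ i) = filling μ i := Subtype.ext (Prod.ext h1 (h i))
        simpa using congrArg Fin.val ((filling μ).injective this)
      · simp
    · simp
  -- Every row permutation fixes that word, so the symmetrizer contributes the order of the row
  -- group.
  have ha : ∀ B : Op d n, (L (rowSym μ) * B) row row = (Finset.univ.filter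
      fun σ : Equiv.Perm (Fin n) => ∀ i, (filling μ (σ i)).1.1 = (filling μ i).1.1).card *
        B row row := by
    intro B
    rw [rowSym, map_sum, Finset.sum_mul, Matrix.sum_apply, Finset.cast_card, Finset.sum_filter,
      Finset.sum_mul]
    refine Finset.sum_congr rfl fun σ _ => ?_
    split_ifs with h
    · rw [hLof, permOp_mul_apply, one_mul]
      congr 1
      ext i
      exact h i
    · simp
  have hne : f (spechtGen μ) row ≠ 0 := by
    change (L (youngSym μ) *ᵥ v) row ≠ 0
    rw [Matrix.mulVec_single_one, Matrix.col_apply, youngSym, map_mul, ha, hb, mul_one]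
    refine Nat.cast_ne_zero.2 (Finset.card_pos.2 ⟨1, ?_⟩).ne'
    simp
  have : Nontrivial (intertwiners d μ) := by
    refine ⟨⟨f, hf⟩, 0, fun h => hne ?_⟩
    have h' : f = 0 := congrArg Subtype.val h
    rw [h']
    rfl
  exact (Module.finrank_pos (R := ℂ) (M := intertwiners d μ)).ne'

/-! ### Multiplicities as traces of matrix units. -/

section TraceMatUnit

variable {μ : YD n} {ι : Type} [Fintype ι] (b : Module.Basis ι ℂ (Specht μ))

lemma matUnit_mulVec_intertwiner (f : intertwiners d μ) (i j k : ι) :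
    matUnit b (permOpHom d n) i j *ᵥ f.1 (b k) = if j = k then f.1 (b i) else 0 := by
  rw [← avg_smul_same b (fun p => f.1 (b p)) i j k, matUnit, Matrix.smul_mulVec,
    Matrix.sum_mulVec]
  congr 1
  refine Finset.sum_congr rfl fun τ _ => ?_
  rw [Matrix.smul_mulVec]
  congr 1
  refine ((mem_intertwiners f.1).1 f.2 τ (b k)).symm.trans ?_
  rw [of_smul_basis, map_sum]
  simp_rw [map_smul]

/-- A diagonal unit is idempotent, so its trace is its rank. Its range is identified with the space
of intertwiners by evaluation at `b i`; the inverse sends `v` to the map `b k ↦ E k i *ᵥ v`. -/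
lemma trace_matUnit_permOp (i j : ι) :
    (matUnit b (permOpHom d n) i j).trace = if i = j then (mult d μ : ℂ) else 0 := by
  set E := matUnit b (permOpHom d n) with hE
  have hEE : ∀ i j k l, E i j * E k l = if j = k then E i l else 0 :=
    matUnit_mul_matUnit b (permOpHom d n)
  split_ifs with hij
  swap
  · have h1 : E i j = E i j * E j j := by rw [hEE, if_pos rfl]
    rw [h1, Matrix.trace_mul_comm, hEE, if_neg (Ne.symm hij), Matrix.trace_zero]
  subst hij
  have hidem : IsIdempotentElem (Matrix.toLin' (E i i)) := by
    rw [IsIdempotentElem, Module.End.mul_eq_comp, ← Matrix.toLin'_mul, hEE, if_pos rfl]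
  have htr := (LinearMap.IsIdempotentElem.isProj_range _ hidem).trace
  rw [Matrix.trace_toLin'_eq] at htr
  rw [htr, mult]
  congr 1
  let g : intertwiners d μ →ₗ[ℂ] LinearMap.range (Matrix.toLin' (E i i)) :=
    { toFun := fun f => ⟨f.1 (b i), f.1 (b i), by
        rw [Matrix.toLin'_apply, hE, matUnit_mulVec_intertwiner, if_pos rfl]⟩
      map_add' := fun _ _ => rfl
      map_smul' := fun _ _ => rfl }
  refine (LinearEquiv.ofBijective g ⟨?_, ?_⟩).finrank_eq.symm
  · rw [injective_iff_map_eq_zero]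
    intro f hf
    have h0 : f.1 (b i) = 0 := congrArg Subtype.val hf
    refine Subtype.ext (b.ext fun k => ?_)
    have := matUnit_mulVec_intertwiner b f k i i
    rw [h0, Matrix.mulVec_zero, if_pos rfl] at this
    exact this.symm
  · rintro ⟨_, v, rfl⟩
    refine ⟨⟨b.constr ℂ fun k => E k i *ᵥ v, (mem_intertwiners _).2 fun σ w =>
      constr_equivariant b (fun σ => Matrix.toLin' (permOp d σ)) _ (fun σ k => ?_) σ w⟩, ?_⟩
    · rw [Matrix.toLin'_apply, Matrix.mulVec_mulVec]
      change (permOpHom d n σ * E k i) *ᵥ v = _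
      rw [hE, mul_matUnit, Matrix.sum_mulVec]
      simp_rw [Matrix.smul_mulVec]
    · refine Subtype.ext ?_
      change b.constr ℂ (fun k => E k i *ᵥ v) (b i) = _
      rw [Module.Basis.constr_basis]
      exact (Matrix.toLin'_apply _ _).symm

end TraceMatUnit

end PermOps

/-! ### Unnormalized maximally entangled projectors -/

section Bell

lemma indicator_congr {p q : Prop} {_ : Decidable p} {_ : Decidable q} (h : p ↔ q) :
    (if p then 1 else 0 : ℂ) = if q then 1 else 0 := if_congr h rfl rfl

variable {d n : ℕ}

/-- The unnormalized projector `d^m ∏_l P⁺_{r_l, s_l}` for a family of pairs `(r_l, s_l)`. -/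
def bell (d : ℕ) {n : ℕ} {ι : Type} (r s : ι → Fin n) : Op d n :=
  Matrix.of fun x y =>
    if (∀ l, x (r l) = x (s l)) ∧ (∀ l, y (r l) = y (s l)) ∧
      ∀ t, (∀ l, t ≠ r l) → (∀ l, t ≠ s l) → x t = y t then 1 else 0

/-- The unnormalized projector `d P⁺_{p, q}` for a single pair. -/
def pairOp (d : ℕ) {n : ℕ} (p q : Fin n) : Op d n := bell d (fun _ : Unit => p) fun _ => q

lemma pairOp_apply (p q : Fin n) (x y : Fin n → Fin d) :
    pairOp d p q x y =
      if x p = x q ∧ y p = y q ∧ ∀ t, t ≠ p → t ≠ q → x t = y t then 1 else 0 := by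
  simp only [pairOp, bell, Matrix.of_apply, forall_const]

lemma maxEnt_eq_smul_pairOp (p q : Fin n) : maxEnt d p q = (d : ℂ)⁻¹ • pairOp d p q := by
  ext x y
  rw [Matrix.smul_apply, pairOp_apply]
  simp [maxEnt]

lemma partialTranspose_swap {p q : Fin n} (h : p ≠ q) :
    partialTranspose q (permOp d (Equiv.swap p q)) = pairOp d p q := by
  ext x y
  rw [pairOp_apply, partialTranspose, permOp, Matrix.of_apply, Matrix.of_apply]
  refine indicator_congr ?_
  rw [Equiv.swap_inv]
  constructor
  · intro H
    have hp := congrFun H p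
    have hq := congrFun H q
    simp only [Function.comp_apply, Equiv.swap_apply_left, Equiv.swap_apply_right,
      Function.update_self, Function.update_of_ne h] at hp hq
    refine ⟨hp, hq.symm, fun t htp htq => ?_⟩
    have ht := congrFun H t
    simpa only [Function.comp_apply, Equiv.swap_apply_of_ne_of_ne htp htq,
      Function.update_of_ne htq] using ht
  · rintro ⟨hp, hq, H⟩
    ext t : 1
    by_cases htq : t = q
    · subst htq
      simp [Function.update_of_ne h, hq]
    by_cases htp : t = p
    · subst htp
      simp [Function.update_of_ne htq, hp]
    simp only [Function.comp_apply, Equiv.swap_apply_of_ne_of_ne htp htq,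
      Function.update_of_ne htq]
    exact H t htp htq

lemma bell_comp_equiv {ι κ : Type} (e : ι ≃ κ) (r s : κ → Fin n) :
    bell d (fun l => r (e l)) (fun l => s (e l)) = bell d r s := by
  ext x y
  simp only [bell, Matrix.of_apply]
  refine indicator_congr ?_
  rw [e.forall_congr_left (p := fun l => x (r (e l)) = x (s (e l))),
    e.forall_congr_left (p := fun l => y (r (e l)) = y (s (e l)))]
  simp only [Equiv.apply_symm_apply]
  refine and_congr_right fun _ => and_congr_right fun _ => forall_congr' fun t => ?_
  rw [e.forall_congr_left (p := fun l => t ≠ r (e l)),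
    e.forall_congr_left (p := fun l => t ≠ s (e l))]
  simp only [Equiv.apply_symm_apply]

lemma permOp_conj_bell {ι : Type} (σ : Equiv.Perm (Fin n)) (r s : ι → Fin n) :
    permOp d σ * bell d r s * permOp d σ⁻¹ = bell d (fun l => σ (r l)) (fun l => σ (s l)) := by
  ext x y
  rw [mul_permOp_apply, permOp_mul_apply]
  simp only [bell, Matrix.of_apply, inv_inv, Function.comp_apply]
  refine indicator_congr (and_congr_right fun _ => and_congr_right fun _ => ?_)
  rw [σ.forall_congr_left]
  simp only [Equiv.apply_symm_apply, ne_eq, Equiv.symm_apply_eq]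

lemma permOp_mul_bell {ι : Type} (σ : Equiv.Perm (Fin n)) (r s : ι → Fin n)
    (hr : ∀ l, σ (r l) = r l) (hs : ∀ l, σ (s l) = s l) :
    permOp d σ * bell d r s = bell d r s * permOp d σ := by
  have h := permOp_conj_bell (d := d) σ r s
  simp only [hr, hs] at h
  conv_rhs => rw [← h, mul_assoc, ← permOp_mul, inv_mul_cancel, permOp_one, mul_one]

lemma bell_transpose {ι : Type} (r s : ι → Fin n) : (bell d r s)ᵀ = bell d r s := by
  ext x y
  simp only [bell, Matrix.transpose_apply, Matrix.of_apply]
  refine indicator_congr ?_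
  constructor <;>
    exact fun ⟨h1, h2, h3⟩ => ⟨h2, h1, fun t ht ht' => (h3 t ht ht').symm⟩

lemma pairOp_mul_apply {p q : Fin n} (h : p ≠ q) (A : Op d n) (x y) :
    (pairOp d p q * A) x y = if x p = x q then
      ∑ c, A (Function.update (Function.update x p c) q c) y else 0 := by
  rw [Matrix.mul_apply]
  simp_rw [pairOp_apply, ite_mul, one_mul, zero_mul]
  split_ifs with hx
  · symm
    refine Finset.sum_of_injOn (fun c => Function.update (Function.update x p c) q c) ?_
      (fun _ _ => Finset.mem_coe.2 (Finset.mem_univ _)) ?_ ?_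
    · intro c _ c' _ hc
      simpa using congrFun hc q
    · intro z _ hz
      rw [if_neg]
      rintro ⟨_, hzp, hzt⟩
      refine hz ⟨z q, by simp, ?_⟩
      ext t : 1
      by_cases htq : t = q
      · subst htq; simp
      by_cases htp : t = p
      · subst htp; simp [Function.update_of_ne htq, hzp]
      simp [Function.update_of_ne htq, Function.update_of_ne htp, hzt t htp htq]
    · intro c _
      rw [if_pos]
      refine ⟨hx, by simp [Function.update_of_ne h], fun t htp htq => ?_⟩
      simp [Function.update_of_ne htq, Function.update_of_ne htp]
  · refine Finset.sum_eq_zero fun z _ => ?_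
    rw [if_neg fun H => hx H.1]

/-- The partial trace over `p` of the swap of `p` and `m` is the identity on `m`. No loop closes, so
no factor `d` appears: only the value `x m` survives in the sum. -/
lemma pairOp_mul_swap_mul_pairOp {p q m : Fin n} (hpq : p ≠ q) (hmp : m ≠ p) (hmq : m ≠ q) :
    pairOp d p q * permOp d (Equiv.swap p m) * pairOp d p q = pairOp d p q := by
  ext x y
  rw [mul_assoc, pairOp_mul_apply hpq, pairOp_apply]
  simp_rw [permOp_mul_apply]
  by_cases hx : x p = x q
  swap
  · rw [if_neg hx, if_neg fun H => hx H.1]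
  rw [if_pos hx, Finset.sum_eq_single (x m)]
  · rw [pairOp_apply]
    refine indicator_congr ?_
    simp only [Function.comp_apply, Equiv.swap_apply_left,
      Equiv.swap_apply_of_ne_of_ne hpq.symm hmq.symm, Function.update_self,
      Function.update_of_ne hmq, Function.update_of_ne hmp, true_and, hx]
    refine and_congr_right fun _ => forall_congr' fun t => ?_
    refine imp_congr_right fun htp => imp_congr_right fun htq => ?_
    by_cases htm : t = m
    · subst htm
      simp [Function.update_of_ne hpq]
    · rw [Equiv.swap_apply_of_ne_of_ne htp htm, Function.update_of_ne htq,
        Function.update_of_ne htp]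
  · intro c _ hc
    rw [pairOp_apply, if_neg]
    rintro ⟨H, -⟩
    simp only [Function.comp_apply, Equiv.swap_apply_left,
      Equiv.swap_apply_of_ne_of_ne hpq.symm hmq.symm, Function.update_self,
      Function.update_of_ne hmq, Function.update_of_ne hmp] at H
    exact hc H.symm
  · simp

variable {ι : Type} {r s : ι → Fin n}

/-- Acting again on a pair that is already coupled closes a loop, with `d` equal contributions. -/
lemma pairOp_mul_bell (hrs : ∀ l l', r l ≠ s l') (hr : Function.Injective r)
    (hs : Function.Injective s) (l : ι) :
    pairOp d (r l) (s l) * bell d r s = (d : ℂ) • bell d r s := by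
  ext x y
  rw [pairOp_mul_apply (hrs l l), Matrix.smul_apply]
  by_cases hx : x (r l) = x (s l)
  swap
  · rw [if_neg hx, bell, Matrix.of_apply, if_neg fun H => hx (H.1 l), smul_zero]
  rw [if_pos hx]
  have : ∀ c, bell d r s (Function.update (Function.update x (r l) c) (s l) c) y =
      bell d r s x y := by
    intro c
    simp only [bell, Matrix.of_apply]
    have hval : ∀ t, t ≠ r l → t ≠ s l →
        Function.update (Function.update x (r l) c) (s l) c t = x t := fun t h1 h2 => by
      rw [Function.update_of_ne h2, Function.update_of_ne h1]
    refine indicator_congr (and_congr ?_ (and_congr_right fun _ => ?_))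
    · refine forall_congr' fun l' => ?_
      by_cases hl : l' = l
      · subst hl
        simp [Function.update_of_ne (hrs l' l'), hx]
      · rw [hval _ (hr.ne hl) (hrs _ _), hval _ (hrs _ _).symm (hs.ne hl)]
    · refine forall_congr' fun t => imp_congr_right fun h1 => imp_congr_right fun h2 => ?_
      rw [hval _ (h1 l) (h2 l)]
  simp [this]

lemma bell_mul_pairOp (hrs : ∀ l l', r l ≠ s l') (hr : Function.Injective r)
    (hs : Function.Injective s) (l : ι) :
    bell d r s * pairOp d (r l) (s l) = (d : ℂ) • bell d r s := by
  have := congrArg Matrix.transpose (pairOp_mul_bell (d := d) hrs hr hs l)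
  rwa [Matrix.transpose_mul, Matrix.transpose_smul, bell_transpose, pairOp, bell_transpose,
    ← pairOp] at this

lemma pairOp_mul_bell_succ {k : ℕ} {r s : Fin (k + 1) → Fin n} (hrs : ∀ l l', r l ≠ s l')
    (hr : Function.Injective r) (hs : Function.Injective s) :
    pairOp d (r 0) (s 0) * bell d (fun l : Fin k => r l.succ) (fun l => s l.succ) =
      bell d r s := by
  ext x y
  rw [pairOp_mul_apply (hrs 0 0)]
  by_cases hx : x (r 0) = x (s 0)
  swap
  · rw [if_neg hx, bell, Matrix.of_apply, if_neg fun H => hx (H.1 0)]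
  rw [if_pos hx]
  have hval : ∀ c t, t ≠ r 0 → t ≠ s 0 →
      Function.update (Function.update x (r 0) c) (s 0) c t = x t := fun c t h1 h2 => by
    rw [Function.update_of_ne h2, Function.update_of_ne h1]
  have hr0 : ∀ l : Fin k, r 0 ≠ r l.succ := fun l => hr.ne (Fin.succ_ne_zero l).symm
  have hs0 : ∀ l : Fin k, s 0 ≠ s l.succ := fun l => hs.ne (Fin.succ_ne_zero l).symm
  -- The shorter family does not couple `r 0`, so it acts there as the identity and forces the
  -- summed value.
  rw [Finset.sum_eq_single (y (r 0))]
  · simp only [bell, Matrix.of_apply]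
    refine indicator_congr ?_
    rw [Fin.forall_fin_succ (P := fun l => x (r l) = x (s l)),
      Fin.forall_fin_succ (P := fun l => y (r l) = y (s l))]
    simp only [hval _ _ (hr0 _).symm (hrs _ _), hval _ _ (hrs _ _).symm (hs0 _).symm, hx,
      true_and]
    constructor
    · rintro ⟨h1, h2, h3⟩
      refine ⟨h1, ⟨?_, h2⟩, fun t h4 h5 => ?_⟩
      · have := h3 (s 0) (fun l => (hrs _ _).symm) hs0
        simpa using this
      · rw [← h3 t (fun l => h4 _) (fun l => h5 _), hval _ _ (h4 0) (h5 0)]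
    · rintro ⟨h1, ⟨h2, h3⟩, h4⟩
      refine ⟨h1, h3, fun t h5 h6 => ?_⟩
      by_cases hts : t = s 0
      · subst hts; simpa using h2
      by_cases htr : t = r 0
      · subst htr; simp [Function.update_of_ne hts]
      rw [hval _ _ htr hts]
      refine h4 t (fun l => ?_) fun l => ?_
      · refine Fin.cases htr (fun l => h5 l) l
      · refine Fin.cases hts (fun l => h6 l) l
  · intro c _ hc
    rw [bell, Matrix.of_apply, if_neg]
    rintro ⟨-, -, H⟩
    have := H (r 0) hr0 (fun l => hrs _ _)
    rw [Function.update_of_ne (hrs 0 0), Function.update_self] at this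
    exact hc this
  · simp

lemma prod_pairOp {k : ℕ} {r s : Fin k → Fin n} (hrs : ∀ l l', r l ≠ s l')
    (hr : Function.Injective r) (hs : Function.Injective s) :
    (List.ofFn fun l => pairOp d (r l) (s l)).prod = bell d r s := by
  induction k with
  | zero =>
    ext x y
    simp [bell, Matrix.one_apply, funext_iff]
  | succ k ih =>
    rw [List.ofFn_succ, List.prod_cons, ih (fun l l' => hrs _ _)
      (hr.comp (Fin.succ_injective k)) (hs.comp (Fin.succ_injective k)),
      pairOp_mul_bell_succ hrs hr hs]

lemma prod_ofFn_smul {k : ℕ} (c : ℂ) (f : Fin k → Op d n) :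
    (List.ofFn fun l => c • f l).prod = c ^ k • (List.ofFn f).prod := by
  induction k with
  | zero => simp
  | succ k ih =>
    rw [List.ofFn_succ, List.prod_cons, ih, List.ofFn_succ, List.prod_cons, smul_mul_smul_comm,
      pow_succ']

lemma bell_mul_self {k : ℕ} {r s : Fin k → Fin n} (hrs : ∀ l l', r l ≠ s l')
    (hr : Function.Injective r) (hs : Function.Injective s) :
    bell d r s * bell d r s = (d : ℂ) ^ k • bell d r s := by
  have key : ∀ L : List (Op d n), (∀ B ∈ L, B * bell d r s = (d : ℂ) • bell d r s) →
      L.prod * bell d r s = (d : ℂ) ^ L.length • bell d r s := by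
    intro L hL
    induction L with
    | nil => simp
    | cons B L ih =>
      rw [List.prod_cons, mul_assoc, ih fun B hB => hL B (List.mem_cons_of_mem _ hB),
        mul_smul_comm, hL B List.mem_cons_self, smul_smul, List.length_cons, pow_succ]
  have h := key (List.ofFn fun l => pairOp d (r l) (s l)) fun B hB => by
    obtain ⟨l, rfl⟩ := (List.mem_ofFn' _ _).1 hB
    exact pairOp_mul_bell hrs hr hs l
  rwa [prod_pairOp hrs hr hs, List.length_ofFn] at h

/-- Compressing a permutation that fixes a set `F` of points, containing all `s_l` and no `r_l`,
is up to a scalar the same as compressing a permutation that fixes `F` and all `r_l`. -/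
lemma bell_mul_permOp_mul_bell (hd : d ≠ 0) [Fintype ι] (hrs : ∀ l l', r l ≠ s l')
    (hr : Function.Injective r) (hs : Function.Injective s) (σ : Equiv.Perm (Fin n))
    (F : Set (Fin n)) (hF : ∀ t ∈ F, σ t = t) (hsF : ∀ l, s l ∈ F) (hrF : ∀ l, r l ∉ F) :
    ∃ (c : ℂ) (κ : Equiv.Perm (Fin n)), (∀ t ∈ F, κ t = t) ∧ (∀ l, κ (r l) = r l) ∧
      bell d r s * permOp d σ * bell d r s = c • (bell d r s * permOp d κ * bell d r s) := by
  have hd' : (d : ℂ) ≠ 0 := Nat.cast_ne_zero.2 hd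
  -- The induction is on the number of coupled points `r l` that `σ` moves.
  induction hm : (Finset.univ.filter fun l => σ (r l) ≠ r l).card using Nat.strong_induction_on
    generalizing σ with
  | _ m ih =>
  by_cases hall : ∀ l, σ (r l) = r l
  · exact ⟨1, σ, hF, hall, by rw [one_smul]⟩
  push Not at hall
  obtain ⟨l, hl⟩ := hall
  set p := r l with hp
  set q := s l with hq
  -- Splitting off this transposition leaves a permutation that fixes `p` together with all points
  -- other than `p` fixed by `σ`. It therefore commutes with the coupling of `p` and `q`.
  set τ := Equiv.swap p (σ p) * σ with hτ
  have hσ : σ = Equiv.swap p (σ p) * τ := by rw [hτ, Equiv.swap_mul_self_mul]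
  have hτp : τ p = p := by rw [hτ, Equiv.Perm.mul_apply, Equiv.swap_apply_right]
  have hσq : σ q = q := hF _ (hsF l)
  have hfix : ∀ t, t ≠ p → σ t = t → τ t = t := by
    intro t htp ht
    rw [hτ, Equiv.Perm.mul_apply, ht]
    refine Equiv.swap_apply_of_ne_of_ne htp fun h => htp ?_
    exact σ.injective (ht.trans h)
  have hτF : ∀ t ∈ F, τ t = t := fun t ht =>
    hfix t (fun h => hrF l (by rw [← hp, ← h]; exact ht)) (hF t ht)
  have hpq : p ≠ q := hrs l l
  have hcard : (Finset.univ.filter fun l => τ (r l) ≠ r l).card < m := by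
    rw [← hm]
    refine Finset.card_lt_card ⟨fun l' hl' => ?_, fun hsub => ?_⟩
    · simp only [Finset.mem_filter, Finset.mem_univ, true_and] at hl' ⊢
      intro h
      by_cases h' : r l' = p
      · exact hl' (h' ▸ hτp)
      · exact hl' (hfix _ h' h)
    · have := hsub (show l ∈ _ by simpa using hl)
      simp only [Finset.mem_filter, Finset.mem_univ, true_and] at this
      exact this hτp
  obtain ⟨c, κ, h1, h2, h3⟩ := ih _ hcard τ hτF rfl
  refine ⟨(d : ℂ)⁻¹ * c, κ, h1, h2, ?_⟩
  rw [mul_smul, ← h3]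
  have hB1 : bell d r s = (d : ℂ)⁻¹ • (bell d r s * pairOp d p q) := by
    rw [bell_mul_pairOp hrs hr hs, inv_smul_smul₀ hd']
  have hB2 : bell d r s = (d : ℂ)⁻¹ • (pairOp d p q * bell d r s) := by
    rw [pairOp_mul_bell hrs hr hs, inv_smul_smul₀ hd']
  have hcomm : permOp d τ * pairOp d p q = pairOp d p q * permOp d τ :=
    permOp_mul_bell τ _ _ (fun _ => hτp) fun _ => hfix q hpq.symm hσq
  have hσpq : σ p ≠ q := fun h => hpq (σ.injective (h.trans hσq.symm))
  -- A pair operator is borrowed on each side at the cost of `d⁻¹`; the two contract across the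
  -- transposition to a single one, and reabsorbing it returns one `d`.
  calc bell d r s * permOp d σ * bell d r s
      = ((d : ℂ)⁻¹ * (d : ℂ)⁻¹) • (bell d r s * (pairOp d p q * permOp d (Equiv.swap p (σ p)) *
          (permOp d τ * pairOp d p q)) * bell d r s) := by
        refine (congrArg₂ (fun A B => A * permOp d σ * B) hB1 hB2).trans ?_
        rw [congrArg (permOp d) hσ, permOp_mul]
        simp only [smul_mul_assoc, mul_smul_comm, smul_smul, mul_assoc]
    _ = ((d : ℂ)⁻¹ * (d : ℂ)⁻¹) • (bell d r s * pairOp d p q * permOp d τ * bell d r s) := by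
        rw [hcomm, ← mul_assoc (pairOp d p q * permOp d _),
          pairOp_mul_swap_mul_pairOp hpq hl hσpq, ← mul_assoc]
    _ = (d : ℂ)⁻¹ • (bell d r s * permOp d τ * bell d r s) := by
        rw [bell_mul_pairOp hrs hr hs]
        simp only [smul_mul_assoc, smul_smul]
        rw [inv_mul_cancel_right₀ hd']

end Bell

/-! ### Signals, cosets of `S(N - k)`, and compressions and traces against `V^{(k)}`. -/

section Ports

variable {d N k : ℕ}

/-- The ports `N, N - 1, …, N - k + 1` that `V^{(k)}` couples to the systems
`N + 1, …, N + k`. -/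
def lastPorts (hk : k ≤ N) : Fin k ↪ Fin N where
  toFun l := ⟨N - 1 - l, by omega⟩
  inj' := fun l l' h => by
    have := congrArg Fin.val h
    simp only at this
    ext
    omega

lemma val_lastPorts (hk : k ≤ N) (l : Fin k) : (lastPorts hk l : ℕ) = N - 1 - l := rfl

lemma castAdd_ne_natAdd (i : Fin N) (l : Fin k) : Fin.castAdd k i ≠ Fin.natAdd N l := by
  intro h
  have := congrArg Fin.val h
  simp only [Fin.val_castAdd, Fin.val_natAdd] at this
  omega

/-- The operator coupling port `i_l` to the system `N + l`, for all `l`. -/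
abbrev portBell (d : ℕ) (i : Fin k ↪ Fin N) : Op d (N + k) :=
  bell d (fun l => Fin.castAdd k (i l)) (Fin.natAdd N)

lemma portBell_hyps (i : Fin k ↪ Fin N) :
    (∀ l l', Fin.castAdd k (i l) ≠ Fin.natAdd N l') ∧
      (Function.Injective fun l => Fin.castAdd k (i l)) ∧
        Function.Injective (Fin.natAdd N : Fin k → Fin (N + k)) :=
  ⟨fun _ _ => castAdd_ne_natAdd _ _, fun _ _ h => i.injective (Fin.castAdd_injective _ _ h),
    Fin.natAdd_injective _ _⟩

lemma signal_eq (i : Fin k ↪ Fin N) :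
    signal d N k i = (((d : ℂ) ^ (N - k))⁻¹ * (d : ℂ)⁻¹ ^ k) • portBell d i := by
  obtain ⟨h1, h2, h3⟩ := portBell_hyps i
  rw [signal]
  simp_rw [maxEnt_eq_smul_pairOp]
  rw [prod_ofFn_smul, prod_pairOp h1 h2 h3, smul_smul]

lemma Vk_eq (hk : k ≤ N) : Vk d N k hk = portBell d (lastPorts hk) := by
  have hpq : ∀ j : Fin k, (⟨N - k + j, by omega⟩ : Fin (N + k)) ≠ ⟨N + k - 1 - j, by omega⟩ :=
    fun j h => by
      have := congrArg Fin.val h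
      simp only at this
      omega
  rw [Vk]
  simp_rw [partialTranspose_swap (hpq _)]
  rw [prod_pairOp]
  -- `Vk` lists its pairs in the opposite order: `j = k - 1 - l` turns the pair `(N - k + j, N + k -
  -- 1 - j)` into `(N - 1 - l, N + l)`.
  · rw [portBell, ← bell_comp_equiv Fin.revPerm]
    congr 1 <;> ext j <;> simp [val_lastPorts, Fin.val_rev] <;> omega
  · intro l l' h
    have := congrArg Fin.val h
    simp only at this
    omega
  · intro l l' h
    have := congrArg Fin.val h
    simp only at this
    ext
    omega
  · intro l l' h
    have := congrArg Fin.val h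
    simp only at this
    ext
    omega

/-- The representation of the port permutations on all systems. -/
abbrev portHom (d N k : ℕ) : Equiv.Perm (Fin N) →* Op d (N + k) :=
  (permOpHom d (N + k)).comp (emb (Nat.le_add_right N k))

lemma portPerm_conjTranspose (τ : Equiv.Perm (Fin N)) :
    (portPerm d N k τ)ᴴ = portPerm d N k τ⁻¹ := by
  rw [portPerm, permOp_conjTranspose, ← map_inv, portPerm]

lemma emb_castAdd (τ : Equiv.Perm (Fin N)) (i : Fin N) :
    emb (Nat.le_add_right N k) τ (Fin.castAdd k i) = Fin.castAdd k (τ i) :=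
  emb_castLE _ τ i

lemma emb_natAdd (τ : Equiv.Perm (Fin N)) (l : Fin k) :
    emb (Nat.le_add_right N k) τ (Fin.natAdd N l) = Fin.natAdd N l :=
  emb_of_le _ τ _ (by simp)

lemma portPerm_conj_portBell (τ : Equiv.Perm (Fin N)) (i : Fin k ↪ Fin N) :
    portPerm d N k τ * portBell d i * portPerm d N k τ⁻¹ =
      portBell d (i.trans τ.toEmbedding) := by
  rw [portPerm, portPerm, map_inv, permOp_conj_bell]
  congr 1
  · ext l
    rw [emb_castAdd]
    rfl
  · ext l
    rw [emb_natAdd]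

lemma mem_range_emb {m n : ℕ} (h : m ≤ n) {σ : Equiv.Perm (Fin n)} :
    σ ∈ (emb h).range ↔ ∀ i : Fin n, m ≤ i → σ i = i := by
  constructor
  · rintro ⟨κ, rfl⟩ i hi
    exact emb_of_le h κ i hi
  intro H
  have H' : ∀ i : Fin n, m ≤ i → σ⁻¹ i = i := fun i hi => by
    rw [Equiv.Perm.inv_eq_iff_eq, H i hi]
  have hlt : ∀ i : Fin n, (i : ℕ) < m → (σ i : ℕ) < m := fun i hi => by
    by_contra hcon
    have := H' _ (not_lt.1 hcon)
    rw [Equiv.Perm.coe_inv, Equiv.symm_apply_apply] at this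
    rw [← this] at hcon
    exact hcon hi
  have hlt' : ∀ i : Fin n, (i : ℕ) < m → (σ⁻¹ i : ℕ) < m := fun i hi => by
    by_contra hcon
    have := H _ (not_lt.1 hcon)
    rw [Equiv.Perm.coe_inv, Equiv.apply_symm_apply] at this
    rw [Equiv.Perm.coe_inv, ← this] at hcon
    exact hcon hi
  let κ : Equiv.Perm (Fin m) :=
    { toFun := fun i => ⟨σ (Fin.castLE h i), hlt _ i.2⟩
      invFun := fun i => ⟨σ⁻¹ (Fin.castLE h i), hlt' _ i.2⟩
      left_inv := fun i => by
        ext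
        have : Fin.castLE h ⟨σ (Fin.castLE h i), hlt _ i.2⟩ = σ (Fin.castLE h i) := rfl
        simp only [this, Equiv.Perm.coe_inv, Equiv.symm_apply_apply, Fin.val_castLE]
      right_inv := fun i => by
        ext
        have : Fin.castLE h ⟨σ⁻¹ (Fin.castLE h i), hlt' _ i.2⟩ = σ⁻¹ (Fin.castLE h i) := rfl
        change (σ (Fin.castLE h ⟨σ⁻¹ (Fin.castLE h i), hlt' _ i.2⟩) : ℕ) = i
        rw [this, Equiv.Perm.coe_inv, Equiv.apply_symm_apply, Fin.val_castLE] }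
  refine ⟨κ, Equiv.ext fun i => ?_⟩
  by_cases hi : (i : ℕ) < m
  · have : i = Fin.castLE h ⟨i, hi⟩ := rfl
    rw [this, emb_castLE]
    rfl
  · rw [emb_of_le h _ i (not_lt.1 hi), H i (not_lt.1 hi)]

lemma mem_range_emb_iff_lastPorts (hk : k ≤ N) {σ : Equiv.Perm (Fin N)} :
    σ ∈ (emb (Nat.sub_le N k)).range ↔ ∀ l, σ (lastPorts hk l) = lastPorts hk l := by
  rw [mem_range_emb]
  constructor
  · exact fun H l => H _ (by rw [val_lastPorts]; omega)
  · intro H i hi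
    have := H ⟨N - 1 - i, by omega⟩
    have e : lastPorts hk ⟨N - 1 - i, by omega⟩ = i := by
      ext
      change N - 1 - (N - 1 - (i : ℕ)) = i
      omega
    rwa [e] at this

/-- The ports `τ⁻¹(N), τ⁻¹(N - 1), …`. -/
def portsOf (hk : k ≤ N) (τ : Equiv.Perm (Fin N)) : Fin k ↪ Fin N :=
  (lastPorts hk).trans (τ⁻¹).toEmbedding

lemma portPerm_conj_Vk (hk : k ≤ N) (τ : Equiv.Perm (Fin N)) :
    portPerm d N k τ⁻¹ * Vk d N k hk * portPerm d N k τ = portBell d (portsOf hk τ) := by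
  have := portPerm_conj_portBell (d := d) τ⁻¹ (lastPorts hk)
  rwa [inv_inv, ← Vk_eq hk] at this

/-- This is the `k`-transitivity of `S(N)` on the ports. -/
lemma portsOf_surjective (hk : k ≤ N) : Function.Surjective (portsOf (N := N) hk) := by
  intro i
  have := Equiv.Perm.isMultiplyPretransitive (Fin N) k
  obtain ⟨g, hg⟩ := MulAction.exists_smul_eq (Equiv.Perm (Fin N)) (lastPorts hk) i
  refine ⟨g⁻¹, ?_⟩
  rw [← hg]
  ext l
  simp [portsOf, Function.Embedding.smul_apply]

/-- `S(N - k)` is the stabilizer of the last ports, so tuples of ports label its right cosets. -/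
lemma portsOf_eq_iff (hk : k ≤ N) (σ τ : Equiv.Perm (Fin N)) :
    portsOf hk σ = portsOf hk τ ↔ σ * τ⁻¹ ∈ (emb (Nat.sub_le N k)).range := by
  rw [mem_range_emb_iff_lastPorts hk, DFunLike.ext_iff]
  refine forall_congr' fun l => ?_
  simp only [portsOf, Function.Embedding.trans_apply, Equiv.coe_toEmbedding,
    Equiv.Perm.mul_apply]
  rw [Equiv.Perm.inv_eq_iff_eq, eq_comm]

lemma sum_transversal {M : Type*} [AddCommMonoid M] (hk : k ≤ N) (T : Finset (Equiv.Perm (Fin N)))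
    (hT : Subgroup.IsComplement ((emb (Nat.sub_le N k)).range : Set (Equiv.Perm (Fin N)))
      (T : Set (Equiv.Perm (Fin N)))) (G : (Fin k ↪ Fin N) → M) :
    ∑ τ ∈ T, G (portsOf hk τ) = ∑ i, G i := by
  rw [Subgroup.isComplement_iff_existsUnique_mul_inv_mem] at hT
  refine Finset.sum_bij (fun τ _ => portsOf hk τ) (fun _ _ => Finset.mem_univ _) ?_ ?_
    fun _ _ => rfl
  · intro σ hσ τ hτ h
    have h1 := (portsOf_eq_iff hk σ τ).1 h
    obtain ⟨t, -, hu⟩ := hT σ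
    have e1 := hu ⟨σ, hσ⟩ (by
      change σ * σ⁻¹ ∈ (emb (Nat.sub_le N k)).range
      rw [mul_inv_cancel]
      exact one_mem _)
    have e2 := hu ⟨τ, hτ⟩ h1
    exact congrArg Subtype.val (e1.trans e2.symm)
  · intro i _
    obtain ⟨σ, rfl⟩ := portsOf_surjective hk i
    obtain ⟨t, ht, -⟩ := hT σ
    exact ⟨t, t.2, ((portsOf_eq_iff hk σ t).2 ht).symm⟩

lemma mpbt_eq_sum_portBell (hd : 1 ≤ d) (hk : k ≤ N) :
    mpbt d N k = ((d : ℂ) ^ N)⁻¹ • ∑ i : Fin k ↪ Fin N, portBell d i := by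
  have hd' : (d : ℂ) ≠ 0 := Nat.cast_ne_zero.2 (by omega)
  rw [mpbt, Finset.smul_sum]
  refine Finset.sum_congr rfl fun i _ => ?_
  rw [signal_eq]
  congr 1
  rw [inv_pow, ← mul_inv, ← pow_add, Nat.sub_add_cancel hk]

lemma mpbt_eq_transversal (hd : 1 ≤ d) (hk : k ≤ N) (T : Finset (Equiv.Perm (Fin N)))
    (hT : Subgroup.IsComplement ((emb (Nat.sub_le N k)).range : Set (Equiv.Perm (Fin N)))
      (T : Set (Equiv.Perm (Fin N)))) :
    mpbt d N k = ((d : ℂ) ^ N)⁻¹ • ∑ τ ∈ T,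
        portPerm d N k τ⁻¹ * Vk d N k hk * portPerm d N k τ := by
  simp_rw [portPerm_conj_Vk]
  rw [sum_transversal hk T hT, mpbt_eq_sum_portBell hd hk]

/-- Every fibre of `portsOf hk` is a coset with `(N - k)!` elements. Summing over the whole group
instead of a transversal makes orthogonality of matrix elements available. -/
lemma sum_perm_eq {M : Type*} [AddCommGroup M] [Module ℂ M] (hk : k ≤ N)
    (G : (Fin k ↪ Fin N) → M) :
    ∑ τ : Equiv.Perm (Fin N), G (portsOf hk τ) = ((N - k).factorial : ℂ) • ∑ i, G i := by
  obtain ⟨T, hT, -⟩ := Subgroup.exists_isComplement_right (emb (Nat.sub_le N k)).range 1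
  have hTfin : T.Finite := Set.toFinite T
  have hT' := hT
  rw [← hTfin.coe_toFinset] at hT
  rw [← sum_transversal hk hTfin.toFinset hT G]
  let e := Equiv.ofBijective _ hT'
  have hcard : Fintype.card (emb (Nat.sub_le N k)).range = (N - k).factorial := by
    have h1 := Fintype.card_congr
      (MonoidHom.ofInjective (Equiv.Perm.viaEmbeddingHom_injective
        (Fin.castLEEmb (Nat.sub_le N k)))).toEquiv
    rw [Fintype.card_perm, Fintype.card_fin] at h1
    rw [h1]
    exact Fintype.card_congr (Equiv.refl _)
  have hval : ∀ x, G (portsOf hk (e x)) = G (portsOf hk x.2) := by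
    rintro ⟨x, y⟩
    congr 1
    rw [portsOf_eq_iff]
    change x.1 * y.1 * y.1⁻¹ ∈ _
    rw [mul_inv_cancel_right]
    exact x.2
  rw [← e.sum_comp]
  simp_rw [hval]
  rw [Fintype.sum_prod_type]
  simp only [Finset.sum_const, Finset.card_univ]
  have hcard2 : Fintype.card ((emb (Nat.sub_le N k)).range : Set (Equiv.Perm (Fin N))) =
      (N - k).factorial := hcard ▸ Fintype.card_congr (Equiv.refl _)
  rw [hcard2, ← Nat.cast_smul_eq_nsmul ℂ]
  congr 1
  exact (Finset.sum_subtype (p := (· ∈ T)) hTfin.toFinset (fun x => by simp)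
    fun τ => G (portsOf hk τ)).symm

lemma mpbt_eq_sum_perm (hd : 1 ≤ d) (hk : k ≤ N) :
    mpbt d N k = (((d : ℂ) ^ N)⁻¹ * ((N - k).factorial : ℂ)⁻¹) • ∑ τ : Equiv.Perm (Fin N),
        portPerm d N k τ⁻¹ * Vk d N k hk * portPerm d N k τ := by
  have hn : ((N - k).factorial : ℂ) ≠ 0 := Nat.cast_ne_zero.2 (Nat.factorial_ne_zero _)
  simp_rw [portPerm_conj_Vk]
  rw [sum_perm_eq hk fun i => portBell d i, smul_smul, mul_assoc, inv_mul_cancel₀ hn, mul_one,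
    mpbt_eq_sum_portBell hd hk]

lemma Vk_mul_self (hk : k ≤ N) : Vk d N k hk * Vk d N k hk = (d : ℂ) ^ k • Vk d N k hk := by
  obtain ⟨h1, h2, h3⟩ := portBell_hyps (lastPorts hk)
  rw [Vk_eq, bell_mul_self h1 h2 h3]

lemma portPerm_emb_mul_Vk (hk : k ≤ N) (κ : Equiv.Perm (Fin (N - k))) :
    portPerm d N k (emb (Nat.sub_le N k) κ) * Vk d N k hk =
      Vk d N k hk * portPerm d N k (emb (Nat.sub_le N k) κ) := by
  rw [Vk_eq]
  refine permOp_mul_bell _ _ _ (fun l => ?_) fun l => emb_natAdd _ l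
  rw [emb_castAdd, (mem_range_emb_iff_lastPorts hk).1 ⟨κ, rfl⟩ l]

/-- Compressing a port permutation with `V^{(k)}` gives a multiple of a permutation in
`S(N - k)`. -/
lemma Vk_mul_portPerm_mul_Vk (hd : 1 ≤ d) (hk : k ≤ N) (τ : Equiv.Perm (Fin N)) :
    ∃ (c : ℂ) (κ : Equiv.Perm (Fin (N - k))), Vk d N k hk * portPerm d N k τ * Vk d N k hk =
      c • (portPerm d N k (emb (Nat.sub_le N k) κ) * Vk d N k hk) := by
  obtain ⟨h1, h2, h3⟩ := portBell_hyps (lastPorts hk)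
  obtain ⟨c, σ, hσ1, hσ2, hσ3⟩ := bell_mul_permOp_mul_bell (d := d) (by omega) h1 h2 h3
    (emb (Nat.le_add_right N k) τ) (Set.range (Fin.natAdd N : Fin k → Fin (N + k)))
    (by rintro _ ⟨l, rfl⟩; exact emb_natAdd τ l) (fun l => ⟨l, rfl⟩)
    (by rintro l ⟨l', h⟩; exact castAdd_ne_natAdd _ _ h.symm)
  have hσN : ∀ i : Fin (N + k), N ≤ i → σ i = i := by
    intro i hi
    refine hσ1 i ⟨⟨i - N, by omega⟩, ?_⟩
    ext
    simp only [Fin.natAdd_mk]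
    omega
  obtain ⟨σ', rfl⟩ := (mem_range_emb (Nat.le_add_right N k)).2 hσN
  have hfix : ∀ l, σ' (lastPorts hk l) = lastPorts hk l := fun l => by
    have := hσ2 l
    rw [emb_castAdd] at this
    exact Fin.castAdd_injective _ _ this
  obtain ⟨κ, rfl⟩ := (mem_range_emb_iff_lastPorts hk).2 hfix
  -- The power of `d` comes from merging the two copies of `V^{(k)}`, once the remaining permutation
  -- has been commuted past one of them.
  refine ⟨c * (d : ℂ) ^ k, κ, ?_⟩
  have h5 : Vk d N k hk * portPerm d N k τ * Vk d N k hk = c •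
      (Vk d N k hk * portPerm d N k (emb (Nat.sub_le N k) κ) * Vk d N k hk) := by
    rw [Vk_eq]
    exact hσ3
  rw [h5, ← portPerm_emb_mul_Vk, mul_assoc, Vk_mul_self, mul_smul_comm, smul_smul]

/-- The trace of a permutation operator against `V^{(k)}` is its trace on the ports. -/
lemma trace_portPerm_mul_Vk (hk : k ≤ N) (τ : Equiv.Perm (Fin N)) :
    (portPerm d N k τ * Vk d N k hk).trace = (permOp d τ).trace := by
  -- `π` sends a teleported system to its coupled port. A diagonal entry can be nonzero only on
  -- words of the form `y ∘ π`, so the trace reduces to words on the ports.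
  let π : Fin (N + k) → Fin N := Fin.addCases id (lastPorts hk)
  have hπ1 : ∀ i, π (Fin.castAdd k i) = i := fun i => by simp [π]
  have hπ2 : ∀ l, π (Fin.natAdd N l) = lastPorts hk l := fun l => by simp [π]
  simp only [Matrix.trace, Matrix.diag_apply]
  symm
  refine Finset.sum_of_injOn (fun y : Fin N → Fin d => y ∘ π) ?_
    (fun _ _ => Finset.mem_coe.2 (Finset.mem_univ _)) ?_ ?_
  · intro y _ y' _ h
    ext i : 1
    simpa [hπ1] using congrFun h (Fin.castAdd k i)
  · intro x _ hx
    rw [portPerm, permOp_mul_apply, Vk_eq, portBell, bell, Matrix.of_apply, if_neg]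
    rintro ⟨-, h, -⟩
    refine hx ⟨x ∘ Fin.castAdd k, by simp, ?_⟩
    ext i : 1
    induction i using Fin.addCases with
    | left i => simp [hπ1]
    | right l => simp [hπ2, h l]
  · intro y _
    rw [portPerm, permOp_mul_apply, Vk_eq, portBell, bell, Matrix.of_apply, permOp, Matrix.of_apply]
    refine indicator_congr ?_
    simp only [Function.comp_apply, emb_castAdd, emb_natAdd, hπ1, hπ2]
    constructor
    · intro h
      have h' : ∀ i, y (τ i) = y i := fun i => by
        have := congrFun h (τ i)
        simpa using this
      refine ⟨fun l => h' _, fun _ => trivial, fun t _ ht => ?_⟩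
      induction t using Fin.addCases with
      | left i => rw [emb_castAdd, hπ1, hπ1, h']
      | right l => exact absurd rfl (ht l)
    · rintro ⟨h1, -, h3⟩
      have h' : ∀ i, y (τ i) = y i := fun i => by
        by_cases hi : ∃ l, i = lastPorts hk l
        · obtain ⟨l, rfl⟩ := hi
          exact h1 l
        · push Not at hi
          have := h3 (Fin.castAdd k i) (fun l h => hi l (Fin.castAdd_injective _ _ h))
            fun l => castAdd_ne_natAdd _ _
          rwa [emb_castAdd, hπ1, hπ1] at this
      ext i : 1
      have := h' (τ⁻¹ i)
      rw [Equiv.Perm.coe_inv, Equiv.apply_symm_apply] at this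
      exact this

lemma trace_permOp_emb {m n : ℕ} (h : m ≤ n) (κ : Equiv.Perm (Fin m)) :
    (permOp d (emb h κ)).trace = (d : ℂ) ^ (n - m) * (permOp d κ).trace := by
  obtain ⟨j, rfl⟩ := Nat.exists_eq_add_of_le h
  simp only [Matrix.trace, Matrix.diag_apply]
  rw [← (Fin.appendEquiv (α := Fin d) m j).sum_comp, Fintype.sum_prod_type, Finset.mul_sum]
  refine Finset.sum_congr rfl fun u _ => ?_
  have : ∀ v : Fin j → Fin d, permOp d (emb h κ) (Fin.appendEquiv m j (u, v))
      (Fin.appendEquiv m j (u, v)) = permOp d κ u u := by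
    intro v
    rw [permOp, Matrix.of_apply, permOp, Matrix.of_apply]
    refine indicator_congr ?_
    rw [← map_inv]
    change Fin.append u v = Fin.append u v ∘ _ ↔ _
    constructor
    · intro H
      ext i : 1
      have := congrFun H (Fin.castAdd j i)
      rw [Function.comp_apply, emb_castAdd, Fin.append_left, Fin.append_left] at this
      exact this
    · intro H
      ext i : 1
      induction i using Fin.addCases with
      | left i =>
        rw [Function.comp_apply, emb_castAdd, Fin.append_left, Fin.append_left]
        exact congrFun H i
      | right l => rw [Function.comp_apply, emb_natAdd]
  rw [Finset.sum_congr rfl fun v _ => this v]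
  simp

end Ports

/-! ### Finiteness of the index types -/

lemma YoungPath.seq_le {k : ℕ} {μ α : YoungDiagram} (r : YoungPath k μ α) (i : Fin (k + 1)) :
    r.seq i ≤ μ := by
  induction i using Fin.induction with
  | zero => exact r.seq_zero.le
  | succ i ih => exact (r.covBy i).le.trans ih

lemma YoungPath.le {k : ℕ} {μ α : YoungDiagram} (r : YoungPath k μ α) : α ≤ μ :=
  r.seq_last ▸ r.seq_le (Fin.last k)

lemma colLen_mono {μ ν : YoungDiagram} (h : μ ≤ ν) (j : ℕ) : μ.colLen j ≤ ν.colLen j := by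
  rw [YoungDiagram.colLen_eq_card, YoungDiagram.colLen_eq_card]
  exact Finset.card_le_card (Finset.filter_subset_filter _ (YoungDiagram.cells_subset_iff.2 h))

instance finite_youngPath (k : ℕ) (μ α : YoungDiagram) : Finite (YoungPath k μ α) :=
  Finite.of_injective (β := Fin (k + 1) → {ν : YoungDiagram // ν ≤ μ})
    (fun r i => ⟨r.seq i, r.seq_le i⟩) fun _ _ h =>
      YoungPath.ext (funext fun i => congrArg Subtype.val (congrFun h i))

instance finite_idx {N k : ℕ} (μ : YD N) : Finite (Idx k μ) :=
  Finite.of_injective (β := Σ α : YD (N - k), YoungPath k μ.1 α.1 × Fin (dimIrr α))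
    (fun i => ⟨i.α, i.r, i.l⟩) fun i j h => by
      cases i
      cases j
      cases h
      rfl

instance fintypeIdx {N k : ℕ} (μ : YD N) : Fintype (Idx k μ) := Fintype.ofFinite _

instance finite_label (d N k : ℕ) : Finite (Label d N k) :=
  Finite.of_injective
    (β := Σ α : YD (N - k), Σ μ : YD N, YoungPath k μ.1 α.1 × Idx k μ)
    (fun x => ⟨x.α, x.μ, x.r, x.i⟩) fun x y h => by
      cases x
      cases y
      cases h
      rfl

instance fintypeLabel (d N k : ℕ) : Fintype (Label d N k) := Fintype.ofFinite _

/-- A path determines its endpoint, so comparing the sequences avoids an equality between path types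
over different `α`. -/
lemma Idx.eq_of_seq_eq {N k : ℕ} {μ : YD N} {α : YD (N - k)} {r : YoungPath k μ.1 α.1}
    (q : Idx k μ) (h : q.r.seq = r.seq) : ∃ l, q = ⟨α, r, l⟩ := by
  obtain ⟨β, s, l⟩ := q
  have hβ : β = α := Subtype.ext (by rw [← s.seq_last, ← r.seq_last]; exact congrFun h _)
  subst hβ
  obtain rfl : s = r := YoungPath.ext h
  exact ⟨l, rfl⟩

/-! ### Matrix units of the two levels -/

section Levels

variable {d N k : ℕ} (hk : k ≤ N) (R : PRIR N k)

lemma Eop_eq_matUnit (μ : YD N) (i j : Idx k μ) :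
    Eop d R μ i j = matUnit (R.high μ) (portHom d N k) i j := rfl

/-- The permutations in `S(N - k)` as operators on all systems. -/
abbrev lowHom (d N k : ℕ) : Equiv.Perm (Fin (N - k)) →* Op d (N + k) :=
  (portHom d N k).comp (emb (Nat.sub_le N k))

/-- The matrix units of the irreps of `S(N - k)`. -/
abbrev lowUnit (d : ℕ) {N k : ℕ} (R : PRIR N k) (α : YD (N - k)) (a b : Fin (dimIrr α)) :
    Op d (N + k) := matUnit (R.low α) (lowHom d N k) a b

variable {R}

/-- Block diagonality of the restriction: for a fixed path, the units transform under `S(N - k)`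
like the basis of `α`. -/
lemma lowHom_mul_Eop {μ : YD N} {α : YD (N - k)} (r : YoungPath k μ.1 α.1) (j : Idx k μ)
    (κ : Equiv.Perm (Fin (N - k))) (l : Fin (dimIrr α)) :
    lowHom d N k κ * Eop d R μ ⟨α, r, l⟩ j =
      ∑ p, matElt (R.low α) κ p l • Eop d R μ ⟨α, r, p⟩ j := by
  rw [Eop_eq_matUnit]
  refine (mul_matUnit (R.high μ) (portHom d N k) _ _ _).trans ?_
  symm
  refine Finset.sum_of_injOn (fun p => (⟨α, r, p⟩ : Idx k μ)) ?_
    (fun _ _ => Finset.mem_coe.2 (Finset.mem_univ _)) ?_ ?_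
  · intro p _ p' _ h
    cases h
    rfl
  · intro q _ hq
    rw [R.restrict_ne μ q.α α q.r r q.l l κ, zero_smul]
    intro h
    obtain ⟨p, rfl⟩ := q.eq_of_seq_eq h
    exact hq ⟨p, by simp, rfl⟩
  · intro p _
    rw [R.restrict_same, Eop_eq_matUnit]

lemma Eop_mul_lowHom {μ : YD N} {α : YD (N - k)} (r : YoungPath k μ.1 α.1) (j : Idx k μ)
    (κ : Equiv.Perm (Fin (N - k))) (l : Fin (dimIrr α)) :
    Eop d R μ j ⟨α, r, l⟩ * lowHom d N k κ =
      ∑ p, matElt (R.low α) κ l p • Eop d R μ j ⟨α, r, p⟩ := by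
  rw [Eop_eq_matUnit]
  refine (matUnit_mul_of (R.high μ) (portHom d N k) _ _ _).trans ?_
  symm
  refine Finset.sum_of_injOn (fun p => (⟨α, r, p⟩ : Idx k μ)) ?_
    (fun _ _ => Finset.mem_coe.2 (Finset.mem_univ _)) ?_ ?_
  · intro p _ p' _ h
    cases h
    rfl
  · intro q _ hq
    rw [R.restrict_ne μ α q.α r q.r l q.l κ, zero_smul]
    intro h
    obtain ⟨p, rfl⟩ := q.eq_of_seq_eq h.symm
    exact hq ⟨p, by simp, rfl⟩
  · intro p _
    rw [R.restrict_same, Eop_eq_matUnit]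

lemma lowUnit_mul_Eop {μ : YD N} {α : YD (N - k)} (r : YoungPath k μ.1 α.1) (j : Idx k μ)
    (a b l : Fin (dimIrr α)) : lowUnit d R α a b * Eop d R μ ⟨α, r, l⟩ j =
      if b = l then Eop d R μ ⟨α, r, a⟩ j else 0 := by
  convert matUnit_mul_same (R.low α) (lowHom d N k) (fun l => Eop d R μ ⟨α, r, l⟩ j)
    (fun κ l => lowHom_mul_Eop r j κ l) a b l

lemma Eop_mul_lowUnit {μ : YD N} {α : YD (N - k)} (r : YoungPath k μ.1 α.1) (j : Idx k μ)
    (a b l : Fin (dimIrr α)) : Eop d R μ j ⟨α, r, l⟩ * lowUnit d R α a b =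
      if l = a then Eop d R μ j ⟨α, r, b⟩ else 0 := by
  convert mul_matUnit_same (R.low α) (lowHom d N k) (fun l => Eop d R μ j ⟨α, r, l⟩)
    (fun κ l => Eop_mul_lowHom r j κ l) a b l

lemma Eop_mul_Eop_ne {μ ν : YD N} (h : μ ≠ ν) (i j : Idx k μ) (i' j' : Idx k ν) :
    Eop d R μ i j * Eop d R ν i' j' = 0 :=
  matUnit_mul_matUnit_ne (R.high μ) (R.high ν) (portHom d N k) h i j i' j'

lemma Eop_mul_Eop {μ : YD N} (i j i' j' : Idx k μ) :
    Eop d R μ i j * Eop d R μ i' j' = if j = i' then Eop d R μ i j' else 0 :=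
  matUnit_mul_matUnit (R.high μ) (portHom d N k) i j i' j'

lemma lowUnit_mul_Vk (α : YD (N - k)) (a b : Fin (dimIrr α)) :
    lowUnit d R α a b * Vk d N k hk = Vk d N k hk * lowUnit d R α a b := by
  simp only [lowUnit, matUnit, smul_mul_assoc, mul_smul_comm, Finset.sum_mul, Finset.mul_sum]
  congr 1
  exact Finset.sum_congr rfl fun κ _ => congrArg _ (portPerm_emb_mul_Vk hk κ)

lemma trace_Eop_mul_Vk (μ : YD N) (i j : Idx k μ) :
    (Eop d R μ i j * Vk d N k hk).trace = if i = j then (mult d μ : ℂ) else 0 := by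
  rw [← trace_matUnit_permOp (R.high μ) i j]
  simp only [Eop, matUnit, smul_mul_assoc, Finset.sum_mul, Matrix.trace_smul, Matrix.trace_sum,
    trace_portPerm_mul_Vk]
  rfl

/-- Elements of `S(N - k)` leave `k` of the `N` ports idle, and each of these contributes a factor
`d`. -/
lemma trace_lowUnit_mul_Vk (α : YD (N - k)) (a b : Fin (dimIrr α)) :
    (lowUnit d R α a b * Vk d N k hk).trace =
      (d : ℂ) ^ k * if a = b then (mult d α : ℂ) else 0 := by
  have h0 : (matUnit (R.low α) (permOpHom d (N - k)) a b).trace =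
      if a = b then (mult d α : ℂ) else 0 := by
    convert trace_matUnit_permOp (R.low α) a b
  rw [← h0]
  have h : ∀ κ, (lowHom d N k κ * Vk d N k hk).trace =
      (d : ℂ) ^ k * (permOpHom d (N - k) κ).trace := by
    intro κ
    refine (trace_portPerm_mul_Vk hk (emb (Nat.sub_le N k) κ)).trans ?_
    rw [trace_permOp_emb, Nat.sub_sub_self hk]
    rfl
  simp only [lowUnit, matUnit, smul_mul_assoc, Finset.sum_mul, Matrix.trace_smul,
    Matrix.trace_sum, h, smul_eq_mul, Finset.mul_sum]
  exact Finset.sum_congr rfl fun κ _ => by ring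

lemma Eop_eq_zero {μ : YD N} (hμ : d < μ.1.colLen 0) (i j : Idx k μ) : Eop d R μ i j = 0 :=
  matUnit_eq_zero (R.high μ) (portHom d N k) (lift_colAlt_eq_zero _ hμ) i j

/-- Compression of matrix units with `V^{(k)}`, before the scalars are known. -/
lemma Vk_mul_Eop_mul_Vk_sum (hd : 1 ≤ d) (μ : YD N) (i j : Idx k μ) :
    ∃ (c : Equiv.Perm (Fin N) → ℂ) (κ : Equiv.Perm (Fin N) → Equiv.Perm (Fin (N - k))),
      Vk d N k hk * Eop d R μ i j * Vk d N k hk =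
        ∑ τ, c τ • (lowHom d N k (κ τ) * Vk d N k hk) := by
  choose c κ h using fun τ => Vk_mul_portPerm_mul_Vk (N := N) (k := k) hd hk τ
  refine ⟨fun τ => (dimIrr μ : ℂ) / (N.factorial : ℂ) * (matElt (R.high μ) τ⁻¹ j i * c τ), κ, ?_⟩
  simp only [Eop, mul_smul_comm, smul_mul_assoc, Finset.mul_sum, Finset.sum_mul, h, mul_smul,
    Finset.smul_sum]
  rfl

lemma Vk_mul_Eop_mul_Vk_lowUnit {μ : YD N} {α β : YD (N - k)} (r : YoungPath k μ.1 α.1)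
    (s : YoungPath k μ.1 β.1) (a : Fin (dimIrr α)) (b : Fin (dimIrr β)) :
    Vk d N k hk * Eop d R μ ⟨α, r, a⟩ ⟨β, s, b⟩ * Vk d N k hk =
      lowUnit d R α a a * (Vk d N k hk * Eop d R μ ⟨α, r, a⟩ ⟨β, s, b⟩ * Vk d N k hk) *
        lowUnit d R β b b := by
  have h : Eop d R μ ⟨α, r, a⟩ ⟨β, s, b⟩ =
      lowUnit d R α a a * Eop d R μ ⟨α, r, a⟩ ⟨β, s, b⟩ * lowUnit d R β b b := by
    rw [lowUnit_mul_Eop, if_pos rfl, Eop_mul_lowUnit, if_pos rfl]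
  conv_lhs => rw [h]
  simp only [mul_assoc]
  rw [lowUnit_mul_Vk, ← mul_assoc (Vk d N k hk), ← lowUnit_mul_Vk, mul_assoc]

/-- The compression lies in the algebra of `S(N - k)` times `V^{(k)}`, and it is sandwiched between
units of two inequivalent irreps. -/
lemma Vk_mul_Eop_mul_Vk_ne (hd : 1 ≤ d) {μ : YD N} {α β : YD (N - k)} (hαβ : α ≠ β)
    (r : YoungPath k μ.1 α.1) (s : YoungPath k μ.1 β.1) (a : Fin (dimIrr α))
    (b : Fin (dimIrr β)) :
    Vk d N k hk * Eop d R μ ⟨α, r, a⟩ ⟨β, s, b⟩ * Vk d N k hk = 0 := by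
  obtain ⟨c, κ, h⟩ := Vk_mul_Eop_mul_Vk_sum (R := R) hk hd μ ⟨α, r, a⟩ ⟨β, s, b⟩
  rw [Vk_mul_Eop_mul_Vk_lowUnit, h, Finset.mul_sum, Finset.sum_mul]
  refine Finset.sum_eq_zero fun τ _ => ?_
  rw [mul_smul_comm, smul_mul_assoc, mul_assoc, mul_assoc, ← lowUnit_mul_Vk,
    ← mul_assoc (lowHom d N k (κ τ)), mul_matUnit, Finset.sum_mul, Finset.mul_sum]
  refine smul_eq_zero_of_right _ (Finset.sum_eq_zero fun p _ => ?_)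
  rw [smul_mul_assoc, mul_smul_comm, ← mul_assoc, matUnit_mul_matUnit_ne _ _ _ hαβ, zero_mul,
    smul_zero]

/-- Compression of a matrix unit with `V^{(k)}`, i.e. its partial trace over the last ports. -/
lemma Vk_mul_Eop_mul_Vk (hd : 1 ≤ d) {μ : YD N} (hμ : μ.1.colLen 0 ≤ d) {α : YD (N - k)}
    (r s : YoungPath k μ.1 α.1) (a : Fin (dimIrr α)) :
    Vk d N k hk * Eop d R μ ⟨α, r, a⟩ ⟨α, s, a⟩ * Vk d N k hk =
      if r = s then ((mult d μ : ℂ) / (mult d α : ℂ)) • (lowUnit d R α a a * Vk d N k hk)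
        else 0 := by
  have hd' : (d : ℂ) ^ k ≠ 0 := pow_ne_zero _ (Nat.cast_ne_zero.2 (by omega))
  have hα : (mult d α : ℂ) ≠ 0 :=
    Nat.cast_ne_zero.2 (mult_ne_zero ((colLen_mono r.le 0).trans hμ))
  -- Sandwiching an element of the algebra of `S(N - k)` between two copies of the unit `(a, a)`
  -- leaves only a multiple of that unit.
  obtain ⟨z, hz⟩ : ∃ z : ℂ, Vk d N k hk * Eop d R μ ⟨α, r, a⟩ ⟨α, s, a⟩ * Vk d N k hk =
      z • (lowUnit d R α a a * Vk d N k hk) := by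
    obtain ⟨c, κ, h⟩ := Vk_mul_Eop_mul_Vk_sum (R := R) hk hd μ ⟨α, r, a⟩ ⟨α, s, a⟩
    refine ⟨∑ τ, c τ * matElt (R.low α) (κ τ) a a, ?_⟩
    rw [Vk_mul_Eop_mul_Vk_lowUnit, h, Finset.mul_sum, Finset.sum_mul, Finset.sum_smul]
    refine Finset.sum_congr rfl fun τ _ => ?_
    rw [mul_smul_comm, smul_mul_assoc, mul_assoc, mul_assoc, ← lowUnit_mul_Vk,
      ← mul_assoc (lowHom d N k (κ τ)), mul_matUnit, Finset.sum_mul, Finset.mul_sum, mul_smul]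
    congr 1
    rw [Finset.sum_eq_single a]
    · rw [smul_mul_assoc, mul_smul_comm, ← mul_assoc, matUnit_mul_matUnit, if_pos rfl]
    · intro p _ hp
      rw [smul_mul_assoc, mul_smul_comm, ← mul_assoc, matUnit_mul_matUnit, if_neg hp.symm,
        zero_mul, smul_zero]
    · simp
  -- Taking traces determines `z`: the left side is `d ^ k * m_μ` or zero according to the paths,
  -- the right side is `z * d ^ k * m_α`.
  have htr := congrArg Matrix.trace hz
  rw [Matrix.trace_mul_comm, ← mul_assoc, Vk_mul_self, smul_mul_assoc, Matrix.trace_smul,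
    Matrix.trace_mul_comm, trace_Eop_mul_Vk, Matrix.trace_smul, trace_lowUnit_mul_Vk,
    if_pos rfl, smul_eq_mul, smul_eq_mul, mul_left_comm, mul_right_inj' hd'] at htr
  rw [hz]
  by_cases hrs : r = s
  · subst hrs
    rw [if_pos rfl] at htr
    rw [if_pos rfl, htr, mul_div_cancel_right₀ _ hα]
  · rw [if_neg (fun h => hrs (by cases h; rfl))] at htr
    rw [if_neg hrs, (mul_eq_zero.1 htr.symm).resolve_right hα, zero_smul]

/-- Units of `S(N - k)` split off from the two outer factors meet after one passes through
`V^{(k)}`, and units of different irreps annihilate each other. -/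
lemma Eop_mul_Vk_mul_Eop_ne {μ ν : YD N} {α β : YD (N - k)} (hαβ : α ≠ β)
    (r : YoungPath k μ.1 α.1) (s : YoungPath k ν.1 β.1) (a : Fin (dimIrr α))
    (b : Fin (dimIrr β)) (i : Idx k μ) (j : Idx k ν) :
    Eop d R μ i ⟨α, r, a⟩ * Vk d N k hk * Eop d R ν ⟨β, s, b⟩ j = 0 := by
  have h1 : Eop d R μ i ⟨α, r, a⟩ = Eop d R μ i ⟨α, r, a⟩ * lowUnit d R α a a := by
    rw [Eop_mul_lowUnit, if_pos rfl]
  have h2 : Eop d R ν ⟨β, s, b⟩ j = lowUnit d R β b b * Eop d R ν ⟨β, s, b⟩ j := by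
    rw [lowUnit_mul_Eop, if_pos rfl]
  rw [h1, h2, mul_assoc _ (lowUnit d R α a a), lowUnit_mul_Vk]
  simp only [mul_assoc]
  rw [← mul_assoc (lowUnit d R α a a), matUnit_mul_matUnit_ne _ _ _ hαβ, zero_mul, mul_zero,
    mul_zero]

/-- The sandwiches `E V^{(k)} E` reduce to those with a reference index `c`. -/
lemma Eop_mul_Vk_mul_Eop {μ ν : YD N} {α : YD (N - k)}
    (r : YoungPath k μ.1 α.1) (s : YoungPath k ν.1 α.1) (a b c : Fin (dimIrr α))
    (i : Idx k μ) (j : Idx k ν) :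
    Eop d R μ i ⟨α, r, a⟩ * Vk d N k hk * Eop d R ν ⟨α, s, b⟩ j =
      if a = b then Eop d R μ i ⟨α, r, c⟩ * Vk d N k hk * Eop d R ν ⟨α, s, c⟩ j else 0 := by
  have h1 : Eop d R μ i ⟨α, r, a⟩ = Eop d R μ i ⟨α, r, c⟩ * lowUnit d R α c a := by
    rw [Eop_mul_lowUnit, if_pos rfl]
  rw [h1, mul_assoc _ (lowUnit d R α c a), lowUnit_mul_Vk, ← mul_assoc,
    mul_assoc _ (lowUnit d R α c a), lowUnit_mul_Eop, mul_ite, mul_zero]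

end Levels

/-! ### The operator basis -/

section OperatorBasis

variable {d N k : ℕ} (hk : k ≤ N) {R : PRIR N k} (one : ∀ α : YD (N - k), Fin (dimIrr α))

/-- The index `(r_{μ/α}, 1_α)`. -/
abbrev Label.ref (x : Label d N k) : Idx k x.μ := ⟨x.α, x.r, one x.α⟩

/-- The normalization `m_α / √(m_μ m_ν)`. -/
def normCoeff (d : ℕ) (α : YD (N - k)) (μ ν : YD N) : ℂ :=
  (mult d α : ℂ) / (Real.sqrt ((mult d μ : ℝ) * (mult d ν : ℝ)) : ℂ)

lemma Fop_eq (x y : Label d N k) : Fop d hk R one x y = normCoeff d x.α x.μ y.μ •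
    (Eop d R x.μ x.i (x.ref one) * Vk d N k hk * Eop d R y.μ (y.ref one) y.i) := rfl

lemma Label.mult_μ_ne_zero (x : Label d N k) : (mult d x.μ : ℂ) ≠ 0 :=
  Nat.cast_ne_zero.2 (mult_ne_zero x.rows)

lemma Label.mult_α_ne_zero (x : Label d N k) : (mult d x.α : ℂ) ≠ 0 :=
  Nat.cast_ne_zero.2 (mult_ne_zero ((colLen_mono x.r.le 0).trans x.rows))

/-- The two square roots of `m_ν` cancel against the factor `m_ν / m_α` produced by the compression.
-/
lemma normCoeff_mul {α : YD (N - k)} {μ ν ξ : YD N} (hα : (mult d α : ℂ) ≠ 0)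
    (hν : (mult d ν : ℂ) ≠ 0) :
    normCoeff d α μ ν * normCoeff d α ν ξ * ((mult d ν : ℂ) / (mult d α : ℂ)) =
      normCoeff d α μ ξ := by
  simp only [normCoeff]
  rw [Real.sqrt_mul (Nat.cast_nonneg _), Real.sqrt_mul (Nat.cast_nonneg _),
    Real.sqrt_mul (Nat.cast_nonneg _)]
  push_cast
  have h : (Real.sqrt (mult d ν) : ℂ) * (Real.sqrt (mult d ν) : ℂ) = (mult d ν : ℂ) := by
    rw [← Complex.ofReal_mul, Real.mul_self_sqrt (Nat.cast_nonneg _), Complex.ofReal_natCast]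
  rw [← h] at hν ⊢
  have hs : (Real.sqrt (mult d ν) : ℂ) ≠ 0 := left_ne_zero_of_mul hν
  -- If an outer multiplicity vanishes, both sides are `0` by the convention for division by zero.
  by_cases h1 : (Real.sqrt (mult d μ) : ℂ) = 0
  · simp [h1]
  by_cases h2 : (Real.sqrt (mult d ξ) : ℂ) = 0
  · simp [h2]
  field_simp

lemma normCoeff_self {α : YD (N - k)} {μ : YD N} :
    normCoeff d α μ μ = (mult d α : ℂ) / (mult d μ : ℂ) := by
  rw [normCoeff, Real.sqrt_mul_self (Nat.cast_nonneg _), Complex.ofReal_natCast]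

lemma normCoeff_ne_zero {α : YD (N - k)} {μ ν : YD N} (hα : (mult d α : ℂ) ≠ 0)
    (hμ : (mult d μ : ℂ) ≠ 0) (hν : (mult d ν : ℂ) ≠ 0) : normCoeff d α μ ν ≠ 0 := by
  refine div_ne_zero hα (Complex.ofReal_ne_zero.2 (Real.sqrt_ne_zero'.2 ?_))
  have h1 : mult d μ ≠ 0 := Nat.cast_ne_zero.1 hμ
  have h2 : mult d ν ≠ 0 := Nat.cast_ne_zero.1 hν
  exact mul_pos (Nat.cast_pos.2 (Nat.pos_of_ne_zero h1)) (Nat.cast_pos.2 (Nat.pos_of_ne_zero h2))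

lemma Vk_mul_Eop_ref_mul_Vk (hd : 1 ≤ d) (y z : Label d N k) :
    Vk d N k hk * (Eop d R y.μ (y.ref one) y.i * Eop d R z.μ z.i (z.ref one)) * Vk d N k hk =
      if y = z then ((mult d y.μ : ℂ) / (mult d y.α : ℂ)) •
        (lowUnit d R y.α (one y.α) (one y.α) * Vk d N k hk) else 0 := by
  obtain ⟨α, μ, hμ, r, i⟩ := y
  obtain ⟨β, ν, hν, s, j⟩ := z
  dsimp only [Label.ref]
  by_cases h1 : μ = ν
  swap
  · rw [Eop_mul_Eop_ne h1, if_neg (fun h => h1 (congrArg Label.μ h)), mul_zero, zero_mul]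
  subst h1
  by_cases h2 : i = j
  swap
  · rw [Eop_mul_Eop, if_neg h2, if_neg (fun h => h2 (by cases h; rfl)), mul_zero, zero_mul]
  subst h2
  rw [Eop_mul_Eop, if_pos rfl]
  by_cases h3 : α = β
  swap
  · rw [Vk_mul_Eop_mul_Vk_ne hk hd h3, if_neg (fun h => h3 (congrArg Label.α h))]
  subst h3
  rw [Vk_mul_Eop_mul_Vk hk hd hμ]
  by_cases h4 : r = s
  · subst h4
    simp
  · rw [if_neg h4, if_neg (fun h => h4 (by cases h; rfl))]

/-- The inner factors compress to a multiple of the unit at the reference index, which the left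
outer factor absorbs. -/
lemma Fop_mul_Fop (hd : 1 ≤ d) (x y z w : Label d N k) (hxy : x.α = y.α) (hzw : z.α = w.α) :
    Fop d hk R one x y * Fop d hk R one z w = if y = z then Fop d hk R one x w else 0 := by
  have h1 : Fop d hk R one x y * Fop d hk R one z w =
      (normCoeff d x.α x.μ y.μ * normCoeff d z.α z.μ w.μ) • (Eop d R x.μ x.i (x.ref one) *
        (Vk d N k hk * (Eop d R y.μ (y.ref one) y.i * Eop d R z.μ z.i (z.ref one)) *
          Vk d N k hk) * Eop d R w.μ (w.ref one) w.i) := by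
    rw [Fop_eq, Fop_eq, smul_mul_smul_comm]
    simp only [mul_assoc]
  rw [h1, Vk_mul_Eop_ref_mul_Vk hk one hd]
  by_cases h : y = z
  swap
  · rw [if_neg h, if_neg h, mul_zero, zero_mul, smul_zero]
  subst h
  rw [if_pos rfl, if_pos rfl, mul_smul_comm, smul_mul_assoc, smul_smul, ← mul_assoc (Eop d R _ _ _)]
  obtain ⟨α, μ, hμ, r, i⟩ := x
  obtain ⟨β, ν, hν, s, j⟩ := y
  dsimp only at hxy
  subst hxy
  dsimp only [Label.ref]
  rw [Eop_mul_lowUnit, if_pos rfl, Fop_eq]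
  have hα := (⟨α, ν, hν, s, j⟩ : Label d N k).mult_α_ne_zero
  have hν' := (⟨α, ν, hν, s, j⟩ : Label d N k).mult_μ_ne_zero
  rw [normCoeff_mul hα hν']

lemma Fop_eq_zero (x y : Label d N k) (h : x.α ≠ y.α) : Fop d hk R one x y = 0 := by
  rw [Fop_eq, Eop_mul_Vk_mul_Eop_ne hk h, smul_zero]

/-- Cyclicity brings the two outer units together; the remaining trace against `V^{(k)}` is `m_μ`,
and the normalization turns it into `m_α`. -/
lemma trace_Fop (x y : Label d N k) :
    (Fop d hk R one x y).trace = if x = y then (mult d x.α : ℂ) else 0 := by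
  by_cases hα : x.α = y.α
  swap
  · rw [Fop_eq_zero hk one x y hα, Matrix.trace_zero, if_neg fun h => hα (congrArg _ h)]
  rw [Fop_eq, Matrix.trace_smul, Matrix.trace_mul_comm, ← mul_assoc]
  obtain ⟨α, μ, hμ, r, i⟩ := x
  obtain ⟨β, ν, hν, s, j⟩ := y
  dsimp only at hα
  subst hα
  dsimp only [Label.ref]
  by_cases h1 : μ = ν
  swap
  · rw [Eop_mul_Eop_ne (Ne.symm h1), if_neg (fun h => h1 (congrArg Label.μ h)), zero_mul,
      Matrix.trace_zero, smul_zero]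
  subst h1
  by_cases h2 : i = j
  swap
  · rw [Eop_mul_Eop, if_neg (Ne.symm h2), if_neg (fun h => h2 (by cases h; rfl)), zero_mul,
      Matrix.trace_zero, smul_zero]
  subst h2
  rw [Eop_mul_Eop, if_pos rfl, trace_Eop_mul_Vk, normCoeff_self]
  have hμ' := (⟨α, μ, hμ, s, i⟩ : Label d N k).mult_μ_ne_zero
  by_cases h3 : r = s
  · subst h3
    rw [if_pos rfl, if_pos rfl, smul_eq_mul, div_mul_cancel₀ _ hμ']
  · rw [if_neg (fun h => h3 (by cases h; rfl)), if_neg (fun h => h3 (by cases h; rfl)),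
      smul_zero]

variable (R) in
/-- The family of operators indexed by the basis labels. -/
abbrev basisFamily (p : BasisLabel d N k) : Op d (N + k) := Fop d hk R one p.1.1 p.1.2

lemma linearIndependent_basisFamily (hd : 1 ≤ d) :
    LinearIndependent ℂ (basisFamily (d := d) hk R one) := by
  rw [Fintype.linearIndependent_iff]
  rintro g hg ⟨⟨x, y⟩, hxy⟩
  -- For the trace form, `F_{yx}` is dual to `F_{xy}` up to the nonzero factor `m_α`.
  have h1 := congrArg (fun X => (X * Fop d hk R one y x).trace) hg
  simp only [Finset.sum_mul, Matrix.trace_sum, zero_mul, Matrix.trace_zero, smul_mul_assoc,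
    Matrix.trace_smul] at h1
  rw [Finset.sum_eq_single ⟨⟨x, y⟩, hxy⟩] at h1
  · rw [Fop_mul_Fop hk one hd _ _ _ _ hxy hxy.symm, if_pos rfl, trace_Fop, if_pos rfl] at h1
    exact (smul_eq_zero.1 h1).resolve_right x.mult_α_ne_zero
  · rintro ⟨⟨z, w⟩, hzw⟩ _ hne
    rw [Fop_mul_Fop hk one hd _ _ _ _ hzw hxy.symm]
    split_ifs with h
    · rw [trace_Fop, if_neg, smul_zero]
      rintro rfl
      exact hne (Subtype.ext (Prod.ext rfl h))
    · rw [Matrix.trace_zero, smul_zero]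
  · simp

lemma portPerm_mul_Vk_mul_portPerm_mem (τ τ' : Equiv.Perm (Fin N)) :
    portPerm d N k τ * Vk d N k hk * portPerm d N k τ' ∈ idealM d N k hk :=
  Submodule.subset_span ⟨τ, τ'⁻¹, by rw [portPerm_conjTranspose, inv_inv]⟩

lemma Fop_mem (x y : Label d N k) : Fop d hk R one x y ∈ idealM d N k hk := by
  simp only [Fop, Eop, smul_mul_assoc, mul_smul_comm, Finset.sum_mul, Finset.mul_sum]
  refine Submodule.smul_mem _ _ (Submodule.smul_mem _ _ ?_)
  refine Submodule.sum_mem _ fun τ _ => Submodule.smul_mem _ _ (Submodule.smul_mem _ _ ?_)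
  refine Submodule.sum_mem _ fun τ' _ => Submodule.smul_mem _ _ ?_
  exact portPerm_mul_Vk_mul_portPerm_mem hk _ _

/-- A sandwich vanishes if a diagram has too many rows, or if the inner indices differ in `α` or in
`l`. Otherwise the inner index can be moved to the reference index, which gives a multiple of an
`F`. -/
lemma Eop_mul_Vk_mul_Eop_mem {μ ν : YD N} (i a : Idx k μ) (b j : Idx k ν) :
    Eop d R μ i a * Vk d N k hk * Eop d R ν b j ∈
      Submodule.span ℂ (Set.range (basisFamily (d := d) hk R one)) := by
  by_cases hμ : d < μ.1.colLen 0
  · rw [Eop_eq_zero hμ, zero_mul, zero_mul]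
    exact Submodule.zero_mem _
  by_cases hν : d < ν.1.colLen 0
  · rw [Eop_eq_zero hν, mul_zero]
    exact Submodule.zero_mem _
  obtain ⟨α, r, l⟩ := a
  obtain ⟨β, s, l'⟩ := b
  by_cases hαβ : α = β
  swap
  · rw [Eop_mul_Vk_mul_Eop_ne hk hαβ]
    exact Submodule.zero_mem _
  subst hαβ
  rw [Eop_mul_Vk_mul_Eop hk r s l l' (one α)]
  split_ifs
  swap
  · exact Submodule.zero_mem _
  let x : Label d N k := ⟨α, μ, not_lt.1 hμ, r, i⟩
  let y : Label d N k := ⟨α, ν, not_lt.1 hν, s, j⟩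
  have h := Fop_eq hk (R := R) one x y
  have hc := normCoeff_ne_zero x.mult_α_ne_zero x.mult_μ_ne_zero y.mult_μ_ne_zero
  have h' : Eop d R μ i ⟨α, r, one α⟩ * Vk d N k hk * Eop d R ν ⟨α, s, one α⟩ j =
      (normCoeff d x.α x.μ y.μ)⁻¹ • Fop d hk R one x y := by
    rw [h, inv_smul_smul₀ hc]
  rw [h']
  exact Submodule.smul_mem _ _ (Submodule.subset_span ⟨⟨(x, y), rfl⟩, rfl⟩)

variable (d R) in
lemma sum_Eop_self : ∑ μ, ∑ i, Eop d R μ i i = 1 := sum_matUnit_self (portHom d N k) R.high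

lemma portPerm_mul_Eop (τ : Equiv.Perm (Fin N)) {μ : YD N} (i j : Idx k μ) :
    portPerm d N k τ * Eop d R μ i j = ∑ c, matElt (R.high μ) τ c i • Eop d R μ c j :=
  mul_matUnit (R.high μ) (portHom d N k) τ i j

lemma Eop_mul_portPerm (τ : Equiv.Perm (Fin N)) {μ : YD N} (i j : Idx k μ) :
    Eop d R μ i j * portPerm d N k τ = ∑ c, matElt (R.high μ) τ j c • Eop d R μ i c :=
  matUnit_mul_of (R.high μ) (portHom d N k) τ i j

lemma Vk_eq_sum : Vk d N k hk = ∑ μ, ∑ a, ∑ ν, ∑ b,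
    Eop d R μ a a * Vk d N k hk * Eop d R ν b b := by
  simp_rw [← Finset.mul_sum, sum_Eop_self, mul_one, ← Finset.sum_mul, sum_Eop_self, one_mul]

variable (R) in
lemma span_basisFamily :
    Submodule.span ℂ (Set.range (basisFamily (d := d) hk R one)) = idealM d N k hk := by
  refine le_antisymm (Submodule.span_le.2 ?_) (Submodule.span_le.2 ?_)
  · rintro _ ⟨p, rfl⟩
    exact Fop_mem hk one _ _
  · rintro _ ⟨τ, τ', rfl⟩
    rw [portPerm_conjTranspose, Vk_eq_sum (R := R)]
    simp only [Finset.mul_sum, Finset.sum_mul]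
    refine Submodule.sum_mem _ fun μ _ => Submodule.sum_mem _ fun a _ =>
      Submodule.sum_mem _ fun ν _ => Submodule.sum_mem _ fun b _ => ?_
    have h : portPerm d N k τ * (Eop d R μ a a * Vk d N k hk * Eop d R ν b b) *
        portPerm d N k τ'⁻¹ = (portPerm d N k τ * Eop d R μ a a) * Vk d N k hk *
          (Eop d R ν b b * portPerm d N k τ'⁻¹) := by
      simp only [mul_assoc]
    rw [h, portPerm_mul_Eop, Eop_mul_portPerm]
    simp only [Finset.mul_sum, Finset.sum_mul, smul_mul_assoc, mul_smul_comm]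
    refine Submodule.sum_mem _ fun c _ => Submodule.smul_mem _ _ ?_
    refine Submodule.sum_mem _ fun e _ => Submodule.smul_mem _ _ ?_
    exact Eop_mul_Vk_mul_Eop_mem hk one _ _ _ _

/-! ### The spectral decomposition of the MPBT operator -/

/-- The sum of all conjugates under permutations of the ports. -/
def twirl (d N k : ℕ) : Op d (N + k) →ₗ[ℂ] Op d (N + k) :=
  ∑ τ : Equiv.Perm (Fin N), LinearMap.mulLeft ℂ (portPerm d N k τ⁻¹) ∘ₗ
    LinearMap.mulRight ℂ (portPerm d N k τ)

lemma twirl_apply (X : Op d (N + k)) : twirl d N k X =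
    ∑ τ : Equiv.Perm (Fin N), portPerm d N k τ⁻¹ * X * portPerm d N k τ := by
  simp [twirl, mul_assoc]

/-- The outer units absorb the permutations and leave only scalar sums of matrix elements, which
orthogonality evaluates whatever `X` is. -/
lemma twirl_sandwich_eq {μ ν : YD N} (a : Idx k μ) (b : Idx k ν) (X : Op d (N + k)) :
    twirl d N k (Eop d R μ a a * X * Eop d R ν b b) = ∑ c, ∑ e,
      (∑ τ : Equiv.Perm (Fin N), matElt (R.high μ) τ⁻¹ c a * matElt (R.high ν) τ b e) •
        (Eop d R μ c a * X * Eop d R ν b e) := by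
  have h : ∀ τ : Equiv.Perm (Fin N), portPerm d N k τ⁻¹ *
      (Eop d R μ a a * X * Eop d R ν b b) * portPerm d N k τ =
      ∑ c, ∑ e, (matElt (R.high μ) τ⁻¹ c a * matElt (R.high ν) τ b e) •
        (Eop d R μ c a * X * Eop d R ν b e) := by
    intro τ
    have h1 : portPerm d N k τ⁻¹ * (Eop d R μ a a * X * Eop d R ν b b) * portPerm d N k τ =
        (portPerm d N k τ⁻¹ * Eop d R μ a a) * X * (Eop d R ν b b * portPerm d N k τ) := by
      simp only [mul_assoc]
    rw [h1, portPerm_mul_Eop, Eop_mul_portPerm, Finset.sum_mul, Finset.sum_mul]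
    refine Finset.sum_congr rfl fun c _ => ?_
    rw [Finset.mul_sum]
    refine Finset.sum_congr rfl fun e _ => ?_
    rw [smul_mul_assoc, smul_mul_smul_comm]
  rw [twirl_apply, Finset.sum_congr rfl fun τ _ => h τ, Finset.sum_comm]
  refine Finset.sum_congr rfl fun c _ => ?_
  rw [Finset.sum_comm]
  refine Finset.sum_congr rfl fun e _ => ?_
  rw [Finset.sum_smul]

lemma twirl_sandwich_ne {μ ν : YD N} (h : μ ≠ ν) (a : Idx k μ) (b : Idx k ν)
    (X : Op d (N + k)) : twirl d N k (Eop d R μ a a * X * Eop d R ν b b) = 0 := by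
  rw [twirl_sandwich_eq]
  simp_rw [matElt_orthogonality_ne (R.high μ) (R.high ν) h, zero_smul, Finset.sum_const_zero]

lemma twirl_sandwich {μ : YD N} (a b : Idx k μ) (X : Op d (N + k)) :
    twirl d N k (Eop d R μ a a * X * Eop d R μ b b) =
      if a = b then ((N.factorial : ℂ) / (dimIrr μ : ℂ)) •
        ∑ c, Eop d R μ c a * X * Eop d R μ a c else 0 := by
  rw [twirl_sandwich_eq]
  simp_rw [matElt_orthogonality]
  by_cases h : a = b
  · subst h
    simp [Finset.smul_sum, ite_smul]
  · simp [h]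

lemma twirl_Vk : twirl d N k (Vk d N k hk) = ∑ μ : YD N, ∑ a : Idx k μ,
    ((N.factorial : ℂ) / (dimIrr μ : ℂ)) •
      ∑ c, Eop d R μ c a * Vk d N k hk * Eop d R μ a c := by
  conv_lhs => rw [Vk_eq_sum (R := R)]
  simp_rw [map_sum]
  refine Finset.sum_congr rfl fun μ _ => Finset.sum_congr rfl fun a _ => ?_
  rw [Finset.sum_eq_single μ]
  · simp_rw [twirl_sandwich]
    simp
  · intro ν _ hν
    exact Finset.sum_eq_zero fun b _ => twirl_sandwich_ne hν.symm a b _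
  · simp

lemma Eop_mul_Vk_mul_Eop_eq_Fop (x : Label d N k) (l : Fin (dimIrr x.α)) :
    Eop d R x.μ x.i ⟨x.α, x.r, l⟩ * Vk d N k hk * Eop d R x.μ ⟨x.α, x.r, l⟩ x.i =
      ((mult d x.μ : ℂ) / (mult d x.α : ℂ)) • Fop d hk R one x x := by
  rw [Eop_mul_Vk_mul_Eop hk _ _ _ _ (one x.α), if_pos rfl, Fop_eq, normCoeff_self, smul_smul,
    div_mul_div_cancel₀ x.mult_α_ne_zero, div_self x.mult_μ_ne_zero, one_smul]

/-- The inner index `a = (α, r, l)` and the outer index `c` combine into the label `(α, μ, r, c)`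
and a free `l`. The summand does not depend on `l`, whence the factor `d_α`. -/
lemma twirl_Vk_eq_sum_Fop : twirl d N k (Vk d N k hk) = ∑ x : Label d N k,
    (((N.factorial : ℂ) / (dimIrr x.μ : ℂ)) * (dimIrr x.α : ℂ) *
      ((mult d x.μ : ℂ) / (mult d x.α : ℂ))) • Fop d hk R one x x := by
  rw [twirl_Vk hk (R := R)]
  simp_rw [Finset.smul_sum, ← Fintype.sum_prod_type']
  rw [← Fintype.sum_sigma' (fun (μ : YD N) (p : Idx k μ × Idx k μ) =>
    ((N.factorial : ℂ) / (dimIrr μ : ℂ)) •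
      (Eop d R μ p.2 p.1 * Vk d N k hk * Eop d R μ p.1 p.2))]
  have h2 : ∀ x : Label d N k, (((N.factorial : ℂ) / (dimIrr x.μ : ℂ)) * (dimIrr x.α : ℂ) *
      ((mult d x.μ : ℂ) / (mult d x.α : ℂ))) • Fop d hk R one x x =
      ∑ l : Fin (dimIrr x.α), ((N.factorial : ℂ) / (dimIrr x.μ : ℂ)) •
        (Eop d R x.μ x.i ⟨x.α, x.r, l⟩ * Vk d N k hk * Eop d R x.μ ⟨x.α, x.r, l⟩ x.i) := by
    intro x
    simp_rw [Eop_mul_Vk_mul_Eop_eq_Fop hk one x]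
    rw [Finset.sum_const, Finset.card_univ, Fintype.card_fin, ← Nat.cast_smul_eq_nsmul ℂ,
      smul_smul, smul_smul]
    congr 1
    ring
  rw [Finset.sum_congr rfl fun x _ => h2 x,
    ← Fintype.sum_sigma' (fun (x : Label d N k) (l : Fin (dimIrr x.α)) =>
      ((N.factorial : ℂ) / (dimIrr x.μ : ℂ)) •
        (Eop d R x.μ x.i ⟨x.α, x.r, l⟩ * Vk d N k hk * Eop d R x.μ ⟨x.α, x.r, l⟩ x.i))]
  symm
  refine Finset.sum_of_injOn
    (fun q : (Σ x : Label d N k, Fin (dimIrr x.α)) =>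
      (⟨q.1.μ, (⟨q.1.α, q.1.r, q.2⟩, q.1.i)⟩ : Σ μ : YD N, Idx k μ × Idx k μ)) ?_
    (fun _ _ => Finset.mem_coe.2 (Finset.mem_univ _)) ?_ fun _ _ => rfl
  · rintro ⟨⟨α, μ, hμ, r, i⟩, l⟩ _ ⟨⟨β, ν, hν, s, j⟩, l'⟩ _ h
    dsimp only at h
    cases h
    rfl
  -- The terms that carry no label are those with more than `d` rows, where the matrix units are
  -- zero.
  · rintro ⟨μ, ⟨α, r, l⟩, i⟩ _ hp
    by_cases hμ : d < μ.1.colLen 0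
    · rw [Eop_eq_zero hμ, zero_mul, zero_mul, smul_zero]
    · exact absurd ⟨⟨⟨α, μ, not_lt.1 hμ, r, i⟩, l⟩, by simp, rfl⟩ hp

/-- The average contributes `N! / (N - k)! = k! C(N,k)`; the other factors of the eigenvalue come
from `twirl_Vk_eq_sum_Fop` and from the prefactor of `ρ`. -/
lemma mpbt_eq_sum_Fop (hd : 1 ≤ d) :
    mpbt d N k = ∑ x : Label d N k, eigval d x.α x.μ • Fop d hk R one x x := by
  rw [mpbt_eq_sum_perm hd hk, ← twirl_apply, twirl_Vk_eq_sum_Fop hk (R := R) one,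
    Finset.smul_sum]
  refine Finset.sum_congr rfl fun x _ => ?_
  rw [smul_smul, eigval]
  congr 1
  have h : (N.factorial : ℂ) = (N.choose k : ℂ) * (k.factorial : ℂ) * ((N - k).factorial : ℂ) := by
    exact_mod_cast (Nat.choose_mul_factorial_mul_factorial hk).symm
  have hn : ((N - k).factorial : ℂ) ≠ 0 := Nat.cast_ne_zero.2 (Nat.factorial_ne_zero _)
  rw [h, div_eq_mul_inv, div_eq_mul_inv (_ * _) ((d : ℂ) ^ N), div_eq_mul_inv (dimIrr x.α : ℂ)]
  calc _ = ((N - k).factorial : ℂ)⁻¹ * ((N - k).factorial : ℂ) * (((k.factorial : ℂ) *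
        (N.choose k : ℂ)) * ((d : ℂ) ^ N)⁻¹ * ((mult d x.μ : ℂ) / (mult d x.α : ℂ)) *
        ((dimIrr x.α : ℂ) * (dimIrr x.μ : ℂ)⁻¹)) := by ring
    _ = _ := by rw [inv_mul_cancel₀ hn, one_mul]

lemma mpbt_mem_idealM (hd : 1 ≤ d) : mpbt d N k ∈ idealM d N k hk := by
  rw [mpbt_eq_sum_perm hd hk]
  exact Submodule.smul_mem _ _
    (Submodule.sum_mem _ fun τ _ => portPerm_mul_Vk_mul_portPerm_mem hk _ _)

variable (R) in
/-- The operators `F` as a basis of the ideal. -/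
def opBasis (hd : 1 ≤ d) : Module.Basis (BasisLabel d N k) ℂ (idealM d N k hk) :=
  (Module.Basis.span (linearIndependent_basisFamily hk (R := R) one hd)).map
    (LinearEquiv.ofEq _ _ (span_basisFamily hk R one))

lemma opBasis_apply (hd : 1 ≤ d) (p : BasisLabel d N k) :
    (opBasis hk R one hd p : Op d (N + k)) = Fop d hk R one p.1.1 p.1.2 := by
  rw [opBasis, Module.Basis.map_apply, LinearEquiv.coe_ofEq_apply, Module.Basis.span_apply]

lemma opBasis_repr_mpbt (hd : 1 ≤ d) (p : BasisLabel d N k) :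
    (opBasis hk R one hd).repr ⟨mpbt d N k, mpbt_mem_idealM hk hd⟩ p =
      if p.1.1 = p.1.2 then eigval d p.1.1.α p.1.1.μ else 0 := by
  have h : (⟨mpbt d N k, mpbt_mem_idealM hk hd⟩ : idealM d N k hk) =
      ∑ p : BasisLabel d N k, (if p.1.1 = p.1.2 then eigval d p.1.1.α p.1.1.μ else 0) •
        opBasis hk R one hd p := by
    refine Subtype.ext ?_
    rw [Submodule.coe_sum]
    simp_rw [Submodule.coe_smul, opBasis_apply]
    rw [mpbt_eq_sum_Fop hk (R := R) one hd]
    refine Finset.sum_of_injOn (fun x : Label d N k => (⟨(x, x), rfl⟩ : BasisLabel d N k)) ?_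
      (fun _ _ => Finset.mem_coe.2 (Finset.mem_univ _)) ?_ ?_
    · intro x _ y _ hxy
      exact congrArg (fun p : BasisLabel d N k => p.1.1) hxy
    · rintro ⟨⟨x, y⟩, hxy⟩ _ hp
      rw [if_neg, zero_smul]
      intro h
      obtain rfl : x = y := h
      exact hp ⟨x, by simp, rfl⟩
    · intro x _
      rw [if_pos rfl]
  rw [h, Module.Basis.repr_sum_self]

lemma trace_mpbt_mul_Fop (hd : 1 ≤ d) (x y : Label d N k) :
    (mult d x.α : ℂ)⁻¹ * Matrix.trace (mpbt d N k * Fop d hk R one x y) =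
      if x = y then eigval d x.α x.μ else 0 := by
  by_cases h : x.α = y.α
  swap
  · rw [Fop_eq_zero hk one x y h, mul_zero, Matrix.trace_zero, mul_zero,
      if_neg fun h' => h (congrArg _ h')]
  rw [mpbt_eq_sum_Fop hk (R := R) one hd, Finset.sum_mul, Matrix.trace_sum,
    Finset.sum_eq_single x]
  · rw [smul_mul_assoc, Fop_mul_Fop hk one hd _ _ _ _ rfl h, if_pos rfl, Matrix.trace_smul,
      trace_Fop]
    split_ifs
    · rw [smul_eq_mul, mul_left_comm, inv_mul_cancel₀ x.mult_α_ne_zero, mul_one]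
    · rw [smul_zero, mul_zero]
  · intro z _ hz
    rw [smul_mul_assoc, Fop_mul_Fop hk one hd _ _ _ _ rfl h, if_neg hz, smul_zero,
      Matrix.trace_zero]
  · simp

end OperatorBasis

end MPBT

end

open scoped Classical in
theorem mainTheorem4 (d N k : ℕ) (hd : 1 ≤ d) (hk : k ≤ N) (R : MPBT.PRIR N k)
    (one : ∀ α : MPBT.YD (N - k), Fin (MPBT.dimIrr α)) :
    -- the MPBT operator as a sum over coset representatives of `S(N - k)` in `S(N)`
    (∀ T : Finset (Equiv.Perm (Fin N)),
      Subgroup.IsComplement ((MPBT.emb (Nat.sub_le N k)).range : Set (Equiv.Perm (Fin N)))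
        (T : Set (Equiv.Perm (Fin N))) →
      MPBT.mpbt d N k = ((d : ℂ) ^ N)⁻¹ • ∑ τ ∈ T,
        MPBT.portPerm d N k τ⁻¹ * MPBT.Vk d N k hk * MPBT.portPerm d N k τ) ∧
    -- the operators `F` form a basis of the ideal, with the composition rule of matrix units,
    -- and in it `ρ` is diagonal with the stated coefficients
    (∃ (B : Module.Basis (MPBT.BasisLabel d N k) ℂ (MPBT.idealM d N k hk))
        (hρ : MPBT.mpbt d N k ∈ MPBT.idealM d N k hk),
      (∀ p, (B p : MPBT.Op d (N + k)) = MPBT.Fop d hk R one p.1.1 p.1.2) ∧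
      (∀ x y z w : MPBT.Label d N k, x.α = y.α → z.α = w.α →
        MPBT.Fop d hk R one x y * MPBT.Fop d hk R one z w =
          if y = z then MPBT.Fop d hk R one x w else 0) ∧
      (∀ p : MPBT.BasisLabel d N k,
        B.repr ⟨MPBT.mpbt d N k, hρ⟩ p =
          if p.1.1 = p.1.2 then MPBT.eigval d p.1.1.α p.1.1.μ else 0)) ∧
    -- the matrix elements as normalized overlaps
    (∀ x y : MPBT.Label d N k,
      (MPBT.mult d x.α : ℂ)⁻¹ *
          Matrix.trace (MPBT.mpbt d N k * MPBT.Fop d hk R one x y) =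
        if x = y then MPBT.eigval d x.α x.μ else 0) := by
  refine ⟨fun T hT => MPBT.mpbt_eq_transversal hd hk T hT,
    ⟨MPBT.opBasis hk R one hd, MPBT.mpbt_mem_idealM hk hd, MPBT.opBasis_apply hk one hd, ?_, ?_⟩, ?_⟩
  · intro x y z w hxy hzw
    exact MPBT.Fop_mul_Fop hk one hd x y z w hxy hzw
  · exact MPBT.opBasis_repr_mpbt hk one hd
  · exact MPBT.trace_mpbt_mul_Fop hk one hd
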